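/- **Setting.** Let $(X_{n,i})_{1\le i\le n,\,n\in\mathbb N}$ be a row-wise stationary triangular scheme of $\mathbb R^d$-valued random vectors with $v_n:=P\{X_{n,1}\neq0\}>0$, let $1\le r_n\le n$ be integers, $m_n:=\lfloor n/r_n\rfloor$, and $Y_{n,j}:=(X_{n,i})_{(j-1)r_n<i\le jr_n}$, $1\le j\le m_n$; $Y_n$ denotes a generic block. Let $\mathcal F$ be a family of cluster functionals, i.e. of measurable functions $f:\bigcup_{l}(\mathbb R^d)^l\to\mathbb R$ with $f(0)=0$ whose value does not change when zeros are added at the beginning and at the end of the argument, such that $f(Y_n)$ is integrable for all $n$. Let $(\xi_j)_{j\in\mathbb N}$ be i.i.d. with $E\xi_j=0$, $\mathrm{Var}(\xi_j)=1$, independent of $(X_{n,i})$ (the data and the multipliers being defined on the two factors of a product probability space). Put, for $f\in\mathcal F$ and $\overline{f(Y_n)}:=m_n^{-1}\sum_{j=1}^{m_n}f(Y_{n,j})$, $$Z_n(f):=\frac1{\sqrt{nv_n}}\sum_{j=1}^{m_n}\big(f(Y_{n,j})-Ef(Y_{n,j})\big),\qquad Z_{n,\xi}(f):=\frac1{\sqrt{nv_n}}\sum_{j=1}^{m_n}\xi_j\big(f(Y_{n,j})-Ef(Y_{n,j})\big),$$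 $$Z^*_{n,\xi}(f):=\frac1{\sqrt{nv_n}}\sum_{j=1}^{m_n}\xi_j\big(f(Y_{n,j})-\overline{f(Y_n)}\big).$$ $E_\xi$ denotes expectation with respect to $(\xi_j)_{j\in\mathbb N}$ for fixed data. For a metric space $S$ let $BL_1(S)$ be the set of all $g:S\to\mathbb R$ with $|g|\le1$ that are Lipschitz with constant $1$; $\mathbb R^l$ carries the maximum norm and the space $\ell^\infty(\mathcal F)$ of bounded functions on $\mathcal F$ the supremum norm. Weak convergence in $\ell^\infty(\mathcal F)$ is understood in the sense of Hoffmann-Jørgensen: the sample paths are bounded (for all large $n$) and the outer expectations of all bounded continuous functions converge. Let $Z$ be a Gaussian process that is a tight Borel random element of $\ell^\infty(\mathcal F)$. **Corollary.** Suppose that 1. for all $l$ and $f_1,\dots,f_l\in\mathcal F$, $$\sup_{g\in BL_1(\mathbb R^l)}\Big|E_\xi\, g\big((Z_{n,\xi}(f_k))_{1\le k\le l}\big)-E\,g\big((Z(f_k))_{1\le k\le l}\big)\Big|\longrightarrow0\quad\text{in probability};$$ 2. (D3) there is a semi-metric $\rho$ on $\mathcal F$ for which $\mathcal F$ is totally bounded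 and $$\lim_{\delta\downarrow0}\ \limsup_{n\to\infty}\ \sup_{f,g\in\mathcal F,\ \rho(f,g)<\delta}\frac1{r_nv_n}E\big(f(Y_n)-g(Y_n)\big)^2=0;$$ 3. $Z_n\to Z$ weakly and $Z_{n,\xi}\to Z$ weakly in $\ell^\infty(\mathcal F)$. Then $$E_\xi\sup_{f\in\mathcal F}\big|Z^*_{n,\xi}(f)-Z_{n,\xi}(f)\big|\longrightarrow0\quad\text{in outer probability},$$ $Z^*_{n,\xi}\to Z$ weakly in $\ell^\infty(\mathcal F)$, and $$\sup_{g\in BL_1(\ell^\infty(\mathcal F))}\big|E_\xi\, g(Z^*_{n,\xi})-E\,g(Z)\big|\longrightarrow0\quad\text{in outer probability}.$$ -/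

import Mathlib

open MeasureTheory ProbabilityTheory Filter Topology Set
open scoped ENNReal BoundedContinuousFunction

noncomputable section

/-! ### Cluster functionals and blocks -/

/-- Vectors of arbitrary length with components in `ℝ^d`.  The `σ`-field is Mathlib's `σ`-field on
a disjoint union, the one induced by the Borel `σ`-fields of the summands. -/
abbrev BlockSpace (d : ℕ) : Type := Σ l : ℕ, (Fin l → Fin d → ℝ)

/-- A cluster functional: a measurable function that vanishes at zero and does not change when
zeros are added at the beginning and at the end of its argument. -/
structure IsClusterFunctional {d : ℕ} (f : BlockSpace d → ℝ) : Prop where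
  measurable : Measurable f
  map_zero : ∀ l : ℕ, f ⟨l, 0⟩ = 0
  map_pad : ∀ (a l b : ℕ) (y : Fin l → Fin d → ℝ),
    f ⟨a + l + b, Fin.append (Fin.append (0 : Fin a → Fin d → ℝ) y) (0 : Fin b → Fin d → ℝ)⟩
      = f ⟨l, y⟩

/-- Row-wise stationarity of the scheme `(X n i)`, `1 ≤ i ≤ n`. -/
def RowwiseStationary {Ω : Type*} [MeasurableSpace Ω] {d : ℕ} (μ : Measure Ω)
    (X : ℕ → ℕ → Ω → Fin d → ℝ) : Prop :=
  ∀ n k h : ℕ, h + k ≤ n →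
    IdentDistrib (fun ω (i : Fin k) => X n (h + i + 1) ω) (fun ω (i : Fin k) => X n (i + 1) ω) μ μ

/-- `v n = P (X n 1 ≠ 0)`. -/
def exceedProb {Ω : Type*} [MeasurableSpace Ω] {d : ℕ} (μ : Measure Ω)
    (X : ℕ → ℕ → Ω → Fin d → ℝ) (n : ℕ) : ℝ :=
  μ.real {ω | X n 1 ω ≠ 0}

/-- The `j`-th block of length `r n` of the `n`-th row; blocks are numbered from `0`, so this is
`(X n i)` with `j * r n < i ≤ (j + 1) * r n`. -/
def block {Ω : Type*} {d : ℕ} (X : ℕ → ℕ → Ω → Fin d → ℝ) (r : ℕ → ℕ) (n j : ℕ) (ω : Ω) :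
    BlockSpace d :=
  ⟨r n, fun i => X n (j * r n + i + 1) ω⟩

/-! ### The empirical process and its multiplier versions (there are `n / r n` blocks, rounded
down) -/

/-- The empirical process `Z_n` of cluster functionals. -/
def empProc {Ω : Type*} [MeasurableSpace Ω] {d : ℕ} (μ : Measure Ω)
    (X : ℕ → ℕ → Ω → Fin d → ℝ) (r : ℕ → ℕ) (𝓕 : Set (BlockSpace d → ℝ))
    (n : ℕ) (ω : Ω) (f : 𝓕) : ℝ :=
  1 / √(n * exceedProb μ X n) *
    ∑ j ∈ Finset.range (n / r n), (f.1 (block X r n j ω) - ∫ ω', f.1 (block X r n j ω') ∂μ)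

/-- The multiplier process `Z_{n,ξ}`; the data live on `Ω₁`, the multipliers on `Ω₂`. -/
def multProc {Ω₁ Ω₂ : Type*} [MeasurableSpace Ω₁] {d : ℕ} (μ : Measure Ω₁)
    (X : ℕ → ℕ → Ω₁ → Fin d → ℝ) (r : ℕ → ℕ) (ξ : ℕ → Ω₂ → ℝ) (𝓕 : Set (BlockSpace d → ℝ))
    (n : ℕ) (ω : Ω₁ × Ω₂) (f : 𝓕) : ℝ :=
  1 / √(n * exceedProb μ X n) *
    ∑ j ∈ Finset.range (n / r n),
      ξ j ω.2 * (f.1 (block X r n j ω.1) - ∫ ω', f.1 (block X r n j ω') ∂μ)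

/-- The empirical block mean of `f`. -/
def blockMean {Ω : Type*} {d : ℕ} (X : ℕ → ℕ → Ω → Fin d → ℝ) (r : ℕ → ℕ)
    (f : BlockSpace d → ℝ) (n : ℕ) (ω : Ω) : ℝ :=
  ((n / r n : ℕ) : ℝ)⁻¹ * ∑ j ∈ Finset.range (n / r n), f (block X r n j ω)

/-- The bootstrap process `Z*_{n,ξ}`, centred at the empirical block means. -/
def bootProc {Ω₁ Ω₂ : Type*} [MeasurableSpace Ω₁] {d : ℕ} (μ : Measure Ω₁)
    (X : ℕ → ℕ → Ω₁ → Fin d → ℝ) (r : ℕ → ℕ) (ξ : ℕ → Ω₂ → ℝ) (𝓕 : Set (BlockSpace d → ℝ))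
    (n : ℕ) (ω : Ω₁ × Ω₂) (f : 𝓕) : ℝ :=
  1 / √(n * exceedProb μ X n) *
    ∑ j ∈ Finset.range (n / r n),
      ξ j ω.2 * (f.1 (block X r n j ω.1) - blockMean X r f.1 n ω.1)

/-! ### Weak convergence in `ℓ^∞`, bounded Lipschitz distance, outer probability -/

/-- The space `ℓ^∞(ι)` of bounded real functions on `ι` with the supremum norm. -/
abbrev LInf (ι : Type*) : Type _ := lp (fun _ : ι => ℝ) ∞

/-- A bounded function as an element of `ℓ^∞(ι)`; the value at unbounded functions is irrelevant
(and is `0`). -/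
def toLInf {ι : Type*} (z : ι → ℝ) : LInf ι :=
  open scoped Classical in if hz : Memℓp z ∞ then ⟨z, hz⟩ else 0

/-- The outer expectation of a bounded function: the infimum of the expectations of its
measurable integrable majorants. -/
def outerExp {Ω : Type*} [MeasurableSpace Ω] (P : Measure Ω) (T : Ω → ℝ) : ℝ :=
  sInf {x | ∃ U : Ω → ℝ, Measurable U ∧ Integrable U P ∧ (∀ ω, T ω ≤ U ω) ∧ ∫ ω, U ω ∂P = x}

/-- `Z` is a random element of `ℓ^∞(ι)`, measurable for the Borel `σ`-field, with tight law. -/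
def IsTightBorel {Ω' ι : Type*} [MeasurableSpace Ω'] (Q : Measure Ω') (Z : Ω' → LInf ι) : Prop :=
  (∀ B : Set (LInf ι), IsOpen B → MeasurableSet (Z ⁻¹' B)) ∧
    ∀ ε : ℝ≥0∞, 0 < ε → ∃ K : Set (LInf ι), IsCompact K ∧ Q (Z ⁻¹' K)ᶜ ≤ ε

/-- Weak convergence in `ℓ^∞(ι)` (in the sense of Hoffmann-Jørgensen): the processes `W n` have
bounded sample paths (for all large `n`) and the outer expectations `E* h(W n)` converge to
`E h(Z)` for all bounded continuous `h`. -/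
def ConvergesWeakly {Ω Ω' ι : Type*} [MeasurableSpace Ω] [MeasurableSpace Ω'] (P : Measure Ω)
    (W : ℕ → Ω → ι → ℝ) (Q : Measure Ω') (Z : Ω' → LInf ι) : Prop :=
  (∀ᶠ n in atTop, ∀ ω, Memℓp (W n ω) ∞) ∧
    ∀ h : LInf ι →ᵇ ℝ,
      Tendsto (fun n => outerExp P (fun ω => h (toLInf (W n ω)))) atTop (𝓝 (∫ ω, h (Z ω) ∂Q))

/-- The functions bounded by `1` and Lipschitz with constant `1`. -/
def BL₁ (E : Type*) [PseudoMetricSpace E] : Set (E → ℝ) :=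
  {g | (∀ z, |g z| ≤ 1) ∧ ∀ z₁ z₂, |g z₁ - g z₂| ≤ dist z₁ z₂}

/-- The bounded Lipschitz distance `sup |E g(V) - E g(W)|`, `g ∈ BL₁ E`, between the laws of two
random elements `V` (under `ν`) and `W` (under `Q`). -/
def dBL {Ω₂ Ω' E : Type*} [MeasurableSpace Ω₂] [MeasurableSpace Ω'] [PseudoMetricSpace E]
    (ν : Measure Ω₂) (V : Ω₂ → E) (Q : Measure Ω') (W : Ω' → E) : ℝ≥0∞ :=
  ⨆ g ∈ BL₁ E, ‖(∫ ω, g (V ω) ∂ν) - ∫ ω, g (W ω) ∂Q‖ₑ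

/-- `T n → 0` in outer probability (a measure applied to an arbitrary set is its outer
measure). -/
def TendstoZeroInOuterProb {Ω : Type*} [MeasurableSpace Ω] (μ : Measure Ω)
    (T : ℕ → Ω → ℝ≥0∞) : Prop :=
  ∀ ε : ℝ≥0∞, 0 < ε → Tendsto (fun n => μ {ω | ε < T n ω}) atTop (𝓝 0)

/-! ### Condition (D3) and conditional convergence of the fidis -/

/-- There is a semi-metric on `𝓕` for which `𝓕` is totally bounded and
`lim_{δ ↓ 0} limsup_n sup_{ρ(f,g) < δ} E (f(Y_n) - g(Y_n))² / (r_n v_n) = 0`. -/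
def ConditionD3 {Ω : Type*} [MeasurableSpace Ω] {d : ℕ} (μ : Measure Ω)
    (X : ℕ → ℕ → Ω → Fin d → ℝ) (r : ℕ → ℕ) (𝓕 : Set (BlockSpace d → ℝ)) : Prop :=
  ∃ ρ : PseudoMetricSpace 𝓕,
    @TotallyBounded 𝓕 ρ.toUniformSpace Set.univ ∧
    Tendsto (fun δ : ℝ =>
      limsup (fun n : ℕ =>
        ⨆ (f : 𝓕) (g : 𝓕) (_ : ρ.dist f g < δ),
          (∫⁻ ω, ENNReal.ofReal ((f.1 (block X r n 0 ω) - g.1 (block X r n 0 ω)) ^ 2) ∂μ) /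
            ENNReal.ofReal (r n * exceedProb μ X n)) atTop)
      (𝓝[>] 0) (𝓝 0)

/-- Conditionally on the data, the fidis of `Z_{n,ξ}` converge weakly to those of `Z`, in
probability.  (`Fin l → ℝ` carries the maximum norm.) -/
def CondFidiConvergence {Ω₁ Ω₂ Ω' : Type*} [MeasurableSpace Ω₁] [MeasurableSpace Ω₂]
    [MeasurableSpace Ω'] {d : ℕ} (μ : Measure Ω₁) (ν : Measure Ω₂)
    (X : ℕ → ℕ → Ω₁ → Fin d → ℝ) (r : ℕ → ℕ) (ξ : ℕ → Ω₂ → ℝ) (𝓕 : Set (BlockSpace d → ℝ))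
    (Q : Measure Ω') (Z : Ω' → LInf 𝓕) : Prop :=
  ∀ (l : ℕ) (f : Fin l → 𝓕),
    TendstoZeroInOuterProb μ (fun n ω₁ =>
      dBL ν (fun ω₂ (k : Fin l) => multProc μ X r ξ 𝓕 n (ω₁, ω₂) (f k))
        Q (fun ω (k : Fin l) => Z ω (f k)))

end

noncomputable section

/-! ### Outer expectations -/

section OuterExpectation

variable {Ω : Type*} [MeasurableSpace Ω] {P : Measure Ω} [IsProbabilityMeasure P]

/-! By stationarity all blocks give `f` the same mean, so replacing the true centring by the
empirical one changes the multiplier process by a product: Z*_{n,ξ} - Z_{n,ξ} = -ξ̄_n Z_n, where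
ξ̄_n is the mean of the first m_n multipliers (`bootProc_eq`). As E|ξ̄_n| ≤ m_n^{-1/2}, the first
two claims reduce to m_n^{-1/2}‖Z_n‖ → 0 in outer probability (`tendsto_measureReal_empProc`), the
second one through Slutsky's lemma.

If m_n → ∞, the reduced claim holds because weak convergence to a tight limit keeps ‖Z_n‖ bounded in
outer probability. Otherwise m_n equals a fixed M infinitely often, and then Z vanishes almost
surely. Indeed, Σ ξ_j a_j over M terms, with the weights a_j given by the data, is close in law to
Z(f); anticoncentration bounds the weights, so Z_n(f) = Σ a_j is bounded and so is Z(f). A bounded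
Gaussian variable is a constant, and the constant is 0 because Σ ξ_j a_j is centred with bounded
variance (`ae_eq_zero_of_frequently_eq`). Tightness passes from the coordinates to Z itself.

For the conditional claim, a compact set carrying most of the law of Z makes Z nearly a function of
finitely many coordinates. Unconditional weak convergence transfers this to Z_{n,ξ}; Fubini and
Markov, applied to a measurable majorant, make it hold conditionally on the data. The fidi
assumption handles the finitely many coordinates, and the first claim passes from Z_{n,ξ} to
Z*_{n,ξ} (`tendstoZeroInOuterProb_dBL`). -/

theorem outerExp_le_integral {T U : Ω → ℝ} {C : ℝ} (hT : ∀ ω, C ≤ T ω) (hUm : Measurable U)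
    (hU : Integrable U P) (hTU : ∀ ω, T ω ≤ U ω) : outerExp P T ≤ ∫ ω, U ω ∂P := by
  refine csInf_le ⟨C, ?_⟩ ⟨U, hUm, hU, hTU, rfl⟩
  rintro x ⟨V, -, hV, hTV, rfl⟩
  calc C = ∫ _, C ∂P := by simp
    _ ≤ ∫ ω, V ω ∂P := integral_mono (integrable_const C) hV fun ω => (hT ω).trans (hTV ω)

theorem exists_majorant_of_outerExp_lt {T : Ω → ℝ} {C x : ℝ} (hT : ∀ ω, T ω ≤ C)
    (hx : outerExp P T < x) :
    ∃ U : Ω → ℝ, Measurable U ∧ Integrable U P ∧ (∀ ω, T ω ≤ U ω) ∧ ∫ ω, U ω ∂P < x := by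
  obtain ⟨y, ⟨U, hUm, hU, hTU, rfl⟩, hy⟩ := exists_lt_of_csInf_lt
    (s := {x | ∃ U : Ω → ℝ, Measurable U ∧ Integrable U P ∧ (∀ ω, T ω ≤ U ω) ∧ ∫ ω, U ω ∂P = x})
    ⟨_, fun _ => C, measurable_const, integrable_const C, hT, rfl⟩ hx
  exact ⟨U, hUm, hU, hTU, hy⟩

/-- Outer expectations are not additive, so comparison goes through majorants: a majorant of `T'`,
raised by `c` everywhere and by `D` on the measurable hull of `A`, majorizes `T`, and the hull has
the measure of `A`. -/
theorem outerExp_le_add {T T' : Ω → ℝ} {C C' c D : ℝ} (hT : ∀ ω, C ≤ T ω)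
    (hT' : ∀ ω, T' ω ≤ C') (hD : 0 ≤ D) (A : Set Ω)
    (h : ∀ ω, T ω ≤ T' ω + c + D * A.indicator 1 ω) :
    outerExp P T ≤ outerExp P T' + c + D * P.real A := by
  refine le_of_forall_pos_lt_add fun ε hε => ?_
  obtain ⟨U, hUm, hU, hTU, hlt⟩ := exists_majorant_of_outerExp_lt (P := P) hT'
    (lt_add_of_pos_right (outerExp P T') hε)
  have hA : MeasurableSet (toMeasurable P A) := measurableSet_toMeasurable P A
  have hi : Integrable ((toMeasurable P A).indicator (1 : Ω → ℝ)) P :=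
    (integrable_const (1 : ℝ)).indicator hA
  have hUc : Integrable (fun ω => U ω + c) P := hU.add (integrable_const c)
  have key : outerExp P T ≤ ∫ ω, (U ω + c + D * (toMeasurable P A).indicator 1 ω) ∂P := by
    refine outerExp_le_integral hT ?_ (hUc.add (hi.const_mul D)) fun ω => ?_
    · exact (hUm.add measurable_const).add ((measurable_one.indicator hA).const_mul D)
    · have h1 := h ω
      have h2 := hTU ω
      have h3 : A.indicator (1 : Ω → ℝ) ω ≤ (toMeasurable P A).indicator 1 ω :=
        indicator_le_indicator_of_subset (subset_toMeasurable P A) (fun _ => zero_le_one) ω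
      have h4 := mul_le_mul_of_nonneg_left h3 hD
      linarith
  rw [integral_add hUc (hi.const_mul D), integral_add hU (integrable_const c),
    integral_const_mul, integral_indicator_one hA] at key
  have hreal : P.real (toMeasurable P A) = P.real A := by
    simp [measureReal_def, measure_toMeasurable]
  simp only [integral_const, probReal_univ, smul_eq_mul, one_mul, hreal] at key
  linarith

/-- Markov's inequality for a majorant. With continuous cutoffs as `T`, it turns weak convergence
into bounds on outer probabilities. -/
theorem measureReal_le_outerExp {T : Ω → ℝ} {C : ℝ} (hT : ∀ ω, T ω ≤ C) (hT0 : ∀ ω, 0 ≤ T ω)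
    {A : Set Ω} (hA : ∀ ω ∈ A, 1 ≤ T ω) : P.real A ≤ outerExp P T := by
  refine le_of_forall_pos_lt_add fun ε hε => ?_
  obtain ⟨U, hUm, hU, hTU, hlt⟩ := exists_majorant_of_outerExp_lt (P := P) hT
    (lt_add_of_pos_right (outerExp P T) hε)
  have h1 : P.real A ≤ P.real {ω | 1 ≤ U ω} :=
    measureReal_mono fun ω hω => (hA ω hω).trans (hTU ω)
  have h2 := mul_meas_ge_le_integral_of_nonneg (μ := P) (f := U)
    (Eventually.of_forall fun ω => (hT0 ω).trans (hTU ω)) hU 1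
  linarith

theorem outerExp_le_measureReal {T : Ω → ℝ} (hT0 : ∀ ω, 0 ≤ T ω) {A : Set Ω}
    (hA : ∀ ω, T ω ≤ A.indicator 1 ω) : outerExp P T ≤ P.real A := by
  have h := outerExp_le_add (P := P) (T := T) (T' := fun _ => 0) (c := 0) hT0 (fun _ => le_rfl)
    zero_le_one A (by simpa using hA)
  have h0 : outerExp P (fun _ => 0) ≤ ∫ _, (0 : ℝ) ∂P :=
    outerExp_le_integral (fun _ => le_rfl) measurable_const (integrable_const _) fun _ => le_rfl
  simp only [integral_zero] at h0
  linarith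

end OuterExpectation

/-! ### Bounded functions -/

section LInf

variable {ι κ : Type*}

theorem toLInf_of_memℓp {z : ι → ℝ} (hz : Memℓp z ∞) : toLInf z = ⟨z, hz⟩ := by
  simp [toLInf, hz]

theorem toLInf_apply {z : ι → ℝ} (hz : Memℓp z ∞) (i : ι) : toLInf z i = z i := by
  rw [toLInf_of_memℓp hz]

theorem LInf.abs_apply_le (z : LInf ι) (i : ι) : |z i| ≤ ‖z‖ :=
  lp.norm_apply_le_norm ENNReal.top_ne_zero z i

theorem LInf.norm_le {z : LInf ι} {C : ℝ} (hC : 0 ≤ C) (h : ∀ i, |z i| ≤ C) : ‖z‖ ≤ C :=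
  lp.norm_le_of_forall_le hC h

theorem LInf.continuous_apply (i : ι) : Continuous fun z : LInf ι => z i := by
  refine (LipschitzWith.of_dist_le_mul (K := 1) fun x y => ?_).continuous
  rw [dist_eq_norm x y, Real.dist_eq, NNReal.coe_one, one_mul]
  exact LInf.abs_apply_le (x - y) i

/-- The bounded function `i ↦ z (s i)`. -/
def LInf.comp (s : κ → ι) (z : LInf ι) : LInf κ :=
  ⟨fun k => z (s k), memℓp_infty ⟨‖z‖, by rintro _ ⟨k, rfl⟩; exact LInf.abs_apply_le z (s k)⟩⟩

theorem LInf.dist_comp_le (s : κ → ι) (z₁ z₂ : LInf ι) :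
    dist (LInf.comp s z₁) (LInf.comp s z₂) ≤ dist z₁ z₂ := by
  rw [dist_eq_norm, dist_eq_norm]
  exact LInf.norm_le (norm_nonneg _) fun k => LInf.abs_apply_le (z₁ - z₂) (s k)

theorem LInf.continuous_comp (s : κ → ι) : Continuous (LInf.comp s) :=
  (LipschitzWith.of_dist_le_mul (K := 1) fun x y => by
    simpa using LInf.dist_comp_le s x y).continuous

/-- The function `i ↦ y (s i)` of finitely many values. -/
def LInf.ofFin {l : ℕ} (s : κ → Fin l) (y : Fin l → ℝ) : LInf κ :=
  ⟨fun k => y (s k), memℓp_infty ⟨‖y‖, by rintro _ ⟨k, rfl⟩; exact norm_le_pi_norm y (s k)⟩⟩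

theorem LInf.dist_ofFin_le {l : ℕ} (s : κ → Fin l) (y₁ y₂ : Fin l → ℝ) :
    dist (LInf.ofFin s y₁) (LInf.ofFin s y₂) ≤ dist y₁ y₂ := by
  rw [dist_eq_norm, dist_eq_norm]
  exact LInf.norm_le (norm_nonneg _) fun k => norm_le_pi_norm (y₁ - y₂) (s k)

/-- On a compact set of bounded functions, the values at finitely many points determine the
functions up to a small error. -/
theorem LInf.exists_finite_approx {K : Set (LInf ι)} (hK : IsCompact K) {ε : ℝ} (hε : 0 < ε) :
    ∃ (l : ℕ) (t : Fin l → ι) (s : ι → Fin l), ∀ z ∈ K, ∀ i, |z i - z (t (s i))| ≤ ε := by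
  have hε3 : 0 < ε / 3 := by positivity
  obtain ⟨c, -, hc, hKc⟩ := Metric.finite_approx_of_totallyBounded hK.totallyBounded _ hε3
  have : Fintype c := hc.fintype
  -- An index is encoded by the values of the finitely many net points of `K` there. The codes form
  -- a bounded set in a finite-dimensional space, so finitely many indices represent all of them up
  -- to `ε / 3`.
  set e : ι → c → ℝ := fun i z => z.1 i with he
  have hsub : range e ⊆ Metric.closedBall 0 (∑ z : c, ‖z.1‖) := by
    rintro _ ⟨i, rfl⟩
    rw [mem_closedBall_zero_iff, pi_norm_le_iff_of_nonneg (by positivity)]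
    intro z
    exact (LInf.abs_apply_le z.1 i).trans
      (Finset.single_le_sum (f := fun z : c => ‖z.1‖) (fun _ _ => norm_nonneg _)
        (Finset.mem_univ z))
  obtain ⟨y, hy, hyf, hcov⟩ := Metric.finite_approx_of_totallyBounded
    ((isCompact_closedBall _ _).totallyBounded.subset hsub) _ hε3
  have : Fintype y := hyf.fintype
  choose p hp using fun k : y => hy k.2
  have hcov' : ∀ i, ∃ k : y, dist (e i) (e (p k)) < ε / 3 := by
    intro i
    have := hcov (mem_range_self i)
    simp only [mem_iUnion, exists_prop, Metric.mem_ball] at this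
    obtain ⟨k, hk, h⟩ := this
    exact ⟨⟨k, hk⟩, by rw [hp]; exact h⟩
  choose s hs using hcov'
  let q := Fintype.equivFin y
  refine ⟨Fintype.card y, fun k => p (q.symm k), fun i => q (s i), fun z hz i => ?_⟩
  simp only [Equiv.symm_apply_apply]
  have := hKc hz
  simp only [mem_iUnion, exists_prop, Metric.mem_ball] at this
  obtain ⟨x, hx, hzx⟩ := this
  rw [dist_eq_norm] at hzx
  have h1 : |z i - x i| ≤ ‖z - x‖ := LInf.abs_apply_le (z - x) i
  have h2 : |z (p (s i)) - x (p (s i))| ≤ ‖z - x‖ := LInf.abs_apply_le (z - x) (p (s i))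
  have h3 : |x i - x (p (s i))| < ε / 3 := by
    have := (dist_le_pi_dist (e i) (e (p (s i))) ⟨x, hx⟩).trans_lt (hs i)
    simpa [he, Real.dist_eq] using this
  rw [abs_le] at h1 h2
  rw [abs_lt] at h3
  rw [abs_le]
  constructor <;> linarith

end LInf

/-! ### Weak convergence to a tight limit -/

section Weak

variable {Ω Ω' ι : Type*} [MeasurableSpace Ω] [MeasurableSpace Ω'] {P : Measure Ω}
  {Q : Measure Ω'} {Z : Ω' → LInf ι}

theorem IsTightBorel.measurable_comp (hZ : IsTightBorel Q Z) {h : LInf ι → ℝ}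
    (hh : Continuous h) : Measurable fun ω => h (Z ω) :=
  measurable_of_isOpen fun _ hs => hZ.1 _ (hs.preimage hh)

theorem IsTightBorel.exists_isCompact (hZ : IsTightBorel Q Z) {ε : ℝ} (hε : 0 < ε) :
    ∃ K : Set (LInf ι), IsCompact K ∧ Q.real (Z ⁻¹' K)ᶜ ≤ ε := by
  obtain ⟨K, hK, h⟩ := hZ.2 (ENNReal.ofReal ε) (by simpa using hε)
  exact ⟨K, hK, ENNReal.toReal_le_of_le_ofReal hε.le h⟩

/-- A continuous function with values in `[0, C]` as a bounded continuous function. -/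
def boundedOfNonneg {E : Type*} [TopologicalSpace E] (h : E → ℝ) (hh : Continuous h) (C : ℝ)
    (h0 : ∀ z, 0 ≤ h z) (hC : ∀ z, h z ≤ C) : E →ᵇ ℝ :=
  BoundedContinuousFunction.ofNormedAddCommGroup h hh C fun z => by
    rw [Real.norm_of_nonneg (h0 z)]; exact hC z

theorem ConvergesWeakly.tendsto_of_nonneg {W : ℕ → Ω → ι → ℝ} (hW : ConvergesWeakly P W Q Z)
    {h : LInf ι → ℝ} (hh : Continuous h) {C : ℝ} (h0 : ∀ z, 0 ≤ h z) (hC : ∀ z, h z ≤ C) :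
    Tendsto (fun n => outerExp P (fun ω => h (toLInf (W n ω)))) atTop (𝓝 (∫ ω, h (Z ω) ∂Q)) :=
  hW.2 (boundedOfNonneg h hh C h0 hC)

variable [IsProbabilityMeasure P] [IsProbabilityMeasure Q]

theorem IsTightBorel.integrable_comp (hZ : IsTightBorel Q Z) {h : LInf ι → ℝ}
    (hh : Continuous h) {C : ℝ} (hC : ∀ z, |h z| ≤ C) : Integrable (fun ω => h (Z ω)) Q :=
  Integrable.of_bound (hZ.measurable_comp hh).aestronglyMeasurable C
    (Eventually.of_forall fun _ => hC _)

/-- The expectation of a function which is small on a compact set of large probability. -/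
theorem IsTightBorel.integral_comp_le (hZ : IsTightBorel Q Z) {h : LInf ι → ℝ}
    (hh : Continuous h) {c C : ℝ} (hc0 : 0 ≤ c) (hC : ∀ z, |h z| ≤ C)
    {K : Set (LInf ι)} (hK : IsCompact K) (hc : ∀ z ∈ K, h z ≤ c) :
    ∫ ω, h (Z ω) ∂Q ≤ c + C * Q.real (Z ⁻¹' K)ᶜ := by
  have hKm : MeasurableSet (Z ⁻¹' K)ᶜ := hZ.1 _ hK.isClosed.isOpen_compl
  have hi : Integrable ((Z ⁻¹' K)ᶜ.indicator (1 : Ω' → ℝ)) Q :=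
    (integrable_const (1 : ℝ)).indicator hKm
  calc ∫ ω, h (Z ω) ∂Q ≤ ∫ ω, (c + C * (Z ⁻¹' K)ᶜ.indicator 1 ω) ∂Q := by
        refine integral_mono (hZ.integrable_comp hh hC)
          ((integrable_const c).add (hi.const_mul C)) fun ω => ?_
        by_cases hω : Z ω ∈ K
        · have : ω ∉ (Z ⁻¹' K)ᶜ := fun h => h hω
          simpa [indicator_of_notMem this] using hc _ hω
        · have : ω ∈ (Z ⁻¹' K)ᶜ := hω
          have h2 := (le_abs_self _).trans (hC (Z ω))
          simp only [indicator_of_mem this, Pi.one_apply, mul_one]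
          linarith
    _ = c + C * Q.real (Z ⁻¹' K)ᶜ := by
        rw [integral_add (integrable_const c) (hi.const_mul C), integral_const_mul,
          integral_indicator_one hKm]
        simp

/-- Slutsky's lemma: a perturbation which tends to zero in outer probability does not change
the weak limit. -/
theorem ConvergesWeakly.of_sub_tendsto_zero {W W' : ℕ → Ω → ι → ℝ} (hZ : IsTightBorel Q Z)
    (hW : ConvergesWeakly P W Q Z) (hW' : ∀ᶠ n in atTop, ∀ ω, Memℓp (W' n ω) ∞)
    (hd : ∀ δ : ℝ, 0 < δ → Tendsto
      (fun n => P.real {ω | δ ≤ ‖toLInf (W' n ω) - toLInf (W n ω)‖}) atTop (𝓝 0)) :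
    ConvergesWeakly P W' Q Z := by
  refine ⟨hW', fun h => ?_⟩
  have hdiff : Tendsto (fun n => outerExp P (fun ω => h (toLInf (W' n ω))) -
      outerExp P (fun ω => h (toLInf (W n ω)))) atTop (𝓝 0) := by
    rw [Metric.tendsto_atTop']
    intro η hη
    -- The final error is at most `2 * ε + 2 * ‖h‖ * (3 * ε)`, which this choice keeps below `η`.
    set ε : ℝ := η / (2 * (2 + 8 * ‖h‖)) with hε_def
    have hε : 0 < ε := by positivity
    obtain ⟨K₀, hK₀, hQ₀⟩ := hZ.exists_isCompact hε
    -- The added point makes `K` nonempty; the distance to an empty set would be `0` by convention.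
    set K := insert 0 K₀ with hK_def
    have hK : IsCompact K := hK₀.insert 0
    have hKne : K.Nonempty := ⟨0, mem_insert _ _⟩
    have hQ : Q.real (Z ⁻¹' K)ᶜ ≤ ε := (measureReal_mono (by
      rw [compl_subset_compl]; exact preimage_mono (subset_insert _ _))).trans hQ₀
    -- Compactness gives one `δ` for all centres in `K`, while `y` may lie outside `K`, where the
    -- processes live.
    obtain ⟨δ, hδ, hδK⟩ : ∃ δ > 0, ∀ x ∈ K, ∀ y, dist x y < δ → dist (h x) (h y) < ε := by
      have := hK.uniformContinuousAt_of_continuousAt (f := h)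
        (fun x _ => h.continuous.continuousAt) (Metric.dist_mem_uniformity hε)
      obtain ⟨δ, hδ, h'⟩ := Metric.mem_uniformity_dist.1 this
      exact ⟨δ, hδ, fun x hx y hxy => h' hxy hx⟩
    -- A continuous cutoff, `0` on `K` and `1` at distance at least `δ / 2`: it shows that `W n` is
    -- close to `K` with large probability.
    set φ : LInf ι → ℝ := fun z => min 1 (Metric.infDist z K / (δ / 2)) with hφ
    have hφc : Continuous φ :=
      continuous_const.min ((Metric.continuous_infDist_pt K).div_const _)
    have hφ0 : ∀ z, 0 ≤ φ z := fun z =>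
      le_min zero_le_one (div_nonneg Metric.infDist_nonneg (by positivity))
    have hφ1 : ∀ z, φ z ≤ 1 := fun z => min_le_left _ _
    have hlim := hW.tendsto_of_nonneg hφc hφ0 hφ1
    have hφZ : ∫ ω, φ (Z ω) ∂Q ≤ ε := by
      have := hZ.integral_comp_le hφc le_rfl
        (fun z => by rw [abs_of_nonneg (hφ0 z)]; exact hφ1 z) hK
        (fun z hz => by simp [hφ, Metric.infDist_zero_of_mem hz])
      linarith
    have hev1 : ∀ᶠ n in atTop, outerExp P (fun ω => φ (toLInf (W n ω))) < 2 * ε :=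
      hlim.eventually_lt_const (by linarith)
    have hev2 := (hd (δ / 2) (by positivity)).eventually_lt_const hε
    obtain ⟨N, hN⟩ := eventually_atTop.1 (hev1.and hev2)
    refine ⟨N, fun n hn => ?_⟩
    obtain ⟨h1, h2⟩ := hN n hn.le
    set A : Set Ω := {ω | 1 ≤ φ (toLInf (W n ω))} ∪
      {ω | δ / 2 ≤ ‖toLInf (W' n ω) - toLInf (W n ω)‖} with hA
    have hPA : P.real A ≤ 3 * ε := by
      have h3 := measureReal_le_outerExp (P := P) (A := {ω | 1 ≤ φ (toLInf (W n ω))})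
        (fun ω => hφ1 (toLInf (W n ω))) (fun ω => hφ0 (toLInf (W n ω))) (fun ω hω => hω)
      have h4 := measureReal_union_le (μ := P) {ω | 1 ≤ φ (toLInf (W n ω))}
        {ω | δ / 2 ≤ ‖toLInf (W' n ω) - toLInf (W n ω)‖}
      linarith
    have hpt : ∀ ω, |h (toLInf (W' n ω)) - h (toLInf (W n ω))| ≤
        2 * ε + 2 * ‖h‖ * A.indicator 1 ω := by
      intro ω
      by_cases hω : ω ∈ A
      · have hb1 := h.norm_coe_le_norm (toLInf (W' n ω))
        have hb2 := h.norm_coe_le_norm (toLInf (W n ω))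
        rw [indicator_of_mem hω, Pi.one_apply, mul_one]
        have := (norm_sub_le (h (toLInf (W' n ω))) (h (toLInf (W n ω))))
        rw [Real.norm_eq_abs] at this
        linarith
      · rw [indicator_of_notMem hω, mul_zero, add_zero]
        simp only [hA, mem_union, mem_ofPred_eq, not_or, not_le] at hω
        have hlt : Metric.infDist (toLInf (W n ω)) K < δ / 2 := by
          have := hω.1
          rw [hφ] at this
          simp only [min_lt_iff, lt_self_iff_false, false_or] at this
          rwa [div_lt_one (by positivity)] at this
        obtain ⟨x, hx, hxd⟩ := (Metric.infDist_lt_iff hKne).1 hlt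
        have e1 := hδK x hx (toLInf (W n ω)) (by rw [dist_comm]; linarith)
        have e2 := hδK x hx (toLInf (W' n ω)) (by
          have := dist_triangle (toLInf (W' n ω)) (toLInf (W n ω)) x
          rw [dist_eq_norm (toLInf (W' n ω)) (toLInf (W n ω))] at this
          rw [dist_comm]
          linarith [hω.2])
        have := dist_triangle_left (h (toLInf (W' n ω))) (h (toLInf (W n ω))) (h x)
        rw [Real.dist_eq] at this
        linarith
    have hb : ∀ z, -‖h‖ ≤ h z ∧ h z ≤ ‖h‖ := fun z => abs_le.1 (h.norm_coe_le_norm z)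
    have g1 := outerExp_le_add (P := P) (T := fun ω => h (toLInf (W' n ω)))
      (T' := fun ω => h (toLInf (W n ω))) (c := 2 * ε) (D := 2 * ‖h‖) (fun ω => (hb _).1)
      (fun ω => (hb _).2) (by positivity) A (fun ω => by linarith [(abs_le.1 (hpt ω)).2])
    have g2 := outerExp_le_add (P := P) (T := fun ω => h (toLInf (W n ω)))
      (T' := fun ω => h (toLInf (W' n ω))) (c := 2 * ε) (D := 2 * ‖h‖) (fun ω => (hb _).1)
      (fun ω => (hb _).2) (by positivity) A (fun ω => by linarith [(abs_le.1 (hpt ω)).1])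
    have g3 : 2 * ‖h‖ * P.real A ≤ 2 * ‖h‖ * (3 * ε) :=
      mul_le_mul_of_nonneg_left hPA (by positivity)
    have g4 : ε * (2 * (2 + 8 * ‖h‖)) = η := by rw [hε_def]; field_simp
    have g5 : 0 ≤ ‖h‖ * ε := by positivity
    rw [Real.dist_eq, sub_zero, abs_lt]
    constructor <;> nlinarith
  simpa using hdiff.add (hW.2 h)

/-- A process which converges weakly to a tight limit is bounded in outer probability. -/
theorem ConvergesWeakly.exists_norm_bound {W : ℕ → Ω → ι → ℝ} (hZ : IsTightBorel Q Z)
    (hW : ConvergesWeakly P W Q Z) {ε : ℝ} (hε : 0 < ε) :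
    ∃ B : ℝ, 0 < B ∧ ∀ᶠ n in atTop, P.real {ω | B ≤ ‖toLInf (W n ω)‖} < ε := by
  obtain ⟨K, hK, hQ⟩ := hZ.exists_isCompact (half_pos hε)
  obtain ⟨b, hb0, hb⟩ := hK.isBounded.exists_pos_norm_le
  -- The cutoff vanishes on the ball of radius `b` containing `K` and equals `1` once the norm
  -- reaches `b + 1`.
  set φ : LInf ι → ℝ := fun z => min 1 (max 0 (‖z‖ - b)) with hφ
  have hφc : Continuous φ := by fun_prop
  have hφ0 : ∀ z, 0 ≤ φ z := fun z => le_min zero_le_one (le_max_left _ _)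
  have hφ1 : ∀ z, φ z ≤ 1 := fun z => min_le_left _ _
  have hφZ := hZ.integral_comp_le hφc le_rfl
    (fun z => by rw [abs_of_nonneg (hφ0 z)]; exact hφ1 z) hK
    (fun z hz => by simp [hφ, hb z hz])
  refine ⟨b + 1, by positivity, ?_⟩
  filter_upwards [(hW.tendsto_of_nonneg hφc hφ0 hφ1).eventually_lt_const
    (show ∫ ω, φ (Z ω) ∂Q < ε by linarith)] with n hn
  refine (measureReal_le_outerExp (fun ω => hφ1 (toLInf (W n ω)))
    (fun ω => hφ0 _) fun ω hω => ?_).trans_lt hn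
  simp only [mem_ofPred_eq] at hω
  exact le_min le_rfl (le_max_of_le_right (by linarith))

end Weak

/-! ### Conditional weak convergence in the bounded Lipschitz distance -/

section Conditional

theorem tendstoZeroInOuterProb_iff {Ω : Type*} [MeasurableSpace Ω] {μ : Measure Ω}
    {T : ℕ → Ω → ℝ≥0∞} :
    TendstoZeroInOuterProb μ T ↔ ∀ ε η : ℝ, 0 < ε → 0 < η →
      ∀ᶠ n in atTop, μ {ω | ENNReal.ofReal ε < T n ω} ≤ ENNReal.ofReal η := by
  constructor
  · intro h ε η hε hη
    exact (h _ (by simpa using hε)).eventually_le_const (by simpa using hη)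
  · intro h ε hε
    rw [ENNReal.tendsto_nhds_zero]
    intro η hη
    rcases eq_or_ne ε ∞ with rfl | hε'
    · simp
    have hη1 : min η 1 ≠ ∞ := by simp
    have hη0 : 0 < min η 1 := lt_min hη zero_lt_one
    filter_upwards [h ε.toReal (min η 1).toReal (ENNReal.toReal_pos hε.ne' hε')
      (ENNReal.toReal_pos hη0.ne' hη1)] with n hn
    rw [ENNReal.ofReal_toReal hε', ENNReal.ofReal_toReal hη1] at hn
    exact hn.trans (min_le_left _ _)

theorem BL₁.continuous {E : Type*} [PseudoMetricSpace E] {g : E → ℝ} (hg : g ∈ BL₁ E) :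
    Continuous g :=
  (LipschitzWith.of_dist_le_mul (K := 1) fun x y => by
    simpa [Real.dist_eq] using hg.2 x y).continuous

theorem BL₁.abs_sub_le {E : Type*} [PseudoMetricSpace E] {g : E → ℝ} (hg : g ∈ BL₁ E)
    (x y : E) : |g x - g y| ≤ min 2 (dist x y) := by
  refine le_min ?_ (hg.2 x y)
  have h1 := abs_le.1 (hg.1 x)
  have h2 := abs_le.1 (hg.1 y)
  rw [abs_le]
  constructor <;> linarith

theorem BL₁.integrable_comp {Ω E : Type*} [MeasurableSpace Ω] [PseudoMetricSpace E]
    {P : Measure Ω} [IsFiniteMeasure P] {g : E → ℝ} (hg : g ∈ BL₁ E) {V : Ω → E}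
    (hV : AEStronglyMeasurable V P) : Integrable (fun ω => g (V ω)) P :=
  Integrable.of_bound ((BL₁.continuous hg).comp_aestronglyMeasurable hV) 1
    (Eventually.of_forall fun _ => hg.1 _)

theorem BL₁.enorm_integral_sub_le {Ω E : Type*} [MeasurableSpace Ω] [PseudoMetricSpace E]
    {P : Measure Ω} {g : E → ℝ} (hg : g ∈ BL₁ E) {V V' : Ω → E}
    (hV : Integrable (fun ω => g (V ω)) P) (hV' : Integrable (fun ω => g (V' ω)) P) :
    ‖(∫ ω, g (V ω) ∂P) - ∫ ω, g (V' ω) ∂P‖ₑ ≤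
      ∫⁻ ω, ENNReal.ofReal (min 2 (dist (V ω) (V' ω))) ∂P := by
  rw [← integral_sub hV hV']
  refine (enorm_integral_le_lintegral_enorm _).trans (lintegral_mono fun ω => ?_)
  rw [Real.enorm_eq_ofReal_abs]
  exact ENNReal.ofReal_le_ofReal (BL₁.abs_sub_le hg _ _)

theorem le_dBL {Ω₂ Ω' E : Type*} [MeasurableSpace Ω₂] [MeasurableSpace Ω'] [PseudoMetricSpace E]
    {ν : Measure Ω₂} {V : Ω₂ → E} {Q : Measure Ω'} {W : Ω' → E} {g : E → ℝ} (hg : g ∈ BL₁ E) :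
    ‖(∫ ω, g (V ω) ∂ν) - ∫ ω, g (W ω) ∂Q‖ₑ ≤ dBL ν V Q W :=
  le_iSup₂ (f := fun g (_ : g ∈ BL₁ E) => ‖(∫ ω, g (V ω) ∂ν) - ∫ ω, g (W ω) ∂Q‖ₑ) g hg

theorem BL₁.comp_ofFin {ι : Type*} {g : LInf ι → ℝ} (hg : g ∈ BL₁ (LInf ι)) {l : ℕ}
    (s : ι → Fin l) : (fun y => g (LInf.ofFin s y)) ∈ BL₁ (Fin l → ℝ) :=
  ⟨fun _ => hg.1 _, fun _ _ => (hg.2 _ _).trans (LInf.dist_ofFin_le s _ _)⟩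

theorem ofFin_eq_comp_toLInf {ι : Type*} {w : ι → ℝ} (hw : Memℓp w ∞) {l : ℕ}
    (t : Fin l → ι) (s : ι → Fin l) :
    LInf.ofFin s (fun k => w (t k)) = LInf.comp (t ∘ s) (toLInf w) := by
  rw [toLInf_of_memℓp hw]
  rfl

theorem ofReal_dist_toLInf_le {ι : Type*} {w w' : ι → ℝ} (hw : Memℓp w ∞) (hw' : Memℓp w' ∞) :
    ENNReal.ofReal (dist (toLInf w) (toLInf w')) ≤ ⨆ i, ‖w i - w' i‖ₑ := by
  rcases eq_or_ne (⨆ i, ‖w i - w' i‖ₑ) ∞ with h | h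
  · simp [h]
  refine ENNReal.ofReal_le_of_le_toReal ?_
  rw [dist_eq_norm]
  refine LInf.norm_le ENNReal.toReal_nonneg fun i => ?_
  have h1 : (toLInf w - toLInf w') i = w i - w' i := by
    rw [toLInf_of_memℓp hw, toLInf_of_memℓp hw']
    rfl
  rw [h1, ← Real.norm_eq_abs, ← toReal_enorm]
  exact ENNReal.toReal_mono h (le_iSup (fun i => ‖w i - w' i‖ₑ) i)

variable {Ω₁ Ω₂ Ω' ι : Type*} [MeasurableSpace Ω₁] [MeasurableSpace Ω₂] [MeasurableSpace Ω']
  {μ : Measure Ω₁} [IsProbabilityMeasure μ] {ν : Measure Ω₂} [IsProbabilityMeasure ν]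
  {Q : Measure Ω'} [IsProbabilityMeasure Q] {Z : Ω' → LInf ι}

/-- Comparison of the bounded Lipschitz distance in `ℓ^∞` with that of finitely many
coordinates. -/
theorem dBL_le_of_finite_approx (hZ : IsTightBorel Q Z) {w w' : Ω₂ → ι → ℝ}
    (hw : ∀ ω, Memℓp (w ω) ∞) (hw' : ∀ ω, Memℓp (w' ω) ∞)
    (hwm : AEStronglyMeasurable (fun ω => toLInf (w ω)) ν)
    (hwm' : AEStronglyMeasurable (fun ω => toLInf (w' ω)) ν)
    {l : ℕ} (t : Fin l → ι) (s : ι → Fin l) :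
    dBL ν (fun ω => toLInf (w' ω)) Q Z ≤
      (∫⁻ ω, ⨆ i, ‖w' ω i - w ω i‖ₑ ∂ν) +
      (∫⁻ ω, ENNReal.ofReal (min 2 (dist (toLInf (w ω)) (LInf.comp (t ∘ s) (toLInf (w ω))))) ∂ν) +
      dBL ν (fun ω k => w ω (t k)) Q (fun ω k => Z ω (t k)) +
      ENNReal.ofReal (∫ ω, min 2 (dist (Z ω) (LInf.comp (t ∘ s) (Z ω))) ∂Q) := by
  refine iSup₂_le fun g hg => ?_
  have hgc := BL₁.continuous hg
  have hcc := LInf.continuous_comp (t ∘ s)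
  have i1 := BL₁.integrable_comp hg hwm'
  have i2 := BL₁.integrable_comp hg hwm
  have i3 := BL₁.integrable_comp hg (hcc.comp_aestronglyMeasurable hwm)
  have i4 : Integrable (fun ω => g (LInf.comp (t ∘ s) (Z ω))) Q :=
    hZ.integrable_comp (h := fun z => g (LInf.comp (t ∘ s) z)) (hgc.comp hcc) (fun z => hg.1 _)
  have i5 : Integrable (fun ω => g (Z ω)) Q := hZ.integrable_comp hgc hg.1
  have h1 := BL₁.enorm_integral_sub_le hg i1 i2
  have h2 := BL₁.enorm_integral_sub_le hg i2 i3
  have h3 := le_dBL (ν := ν) (V := fun ω k => w ω (t k)) (Q := Q)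
    (W := fun ω k => Z ω (t k)) (BL₁.comp_ofFin hg s)
  have h4 := BL₁.enorm_integral_sub_le hg i4 i5
  simp only [ofFin_eq_comp_toLInf (hw _)] at h3
  have hZc : Continuous fun z : LInf ι => min 2 (dist z (LInf.comp (t ∘ s) z)) :=
    continuous_const.min (continuous_id.dist hcc)
  have hZ0 : ∀ z : LInf ι, 0 ≤ min 2 (dist z (LInf.comp (t ∘ s) z)) :=
    fun z => le_min zero_le_two dist_nonneg
  have i6 : Integrable (fun ω => min 2 (dist (Z ω) (LInf.comp (t ∘ s) (Z ω)))) Q :=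
    hZ.integrable_comp hZc (C := 2) fun z => by
      rw [abs_of_nonneg (hZ0 z)]; exact min_le_left _ _
  rw [ofReal_integral_eq_lintegral_ofReal i6 (Eventually.of_forall fun ω => hZ0 _)]
  simp only [dist_comm (LInf.comp (t ∘ s) (Z _))] at h4
  have h1' : (∫⁻ ω, ENNReal.ofReal (min 2 (dist (toLInf (w' ω)) (toLInf (w ω)))) ∂ν) ≤
      ∫⁻ ω, ⨆ i, ‖w' ω i - w ω i‖ₑ ∂ν := lintegral_mono fun ω =>
    (ENNReal.ofReal_le_ofReal (min_le_right _ _)).trans (ofReal_dist_toLInf_le (hw' ω) (hw ω))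
  -- The path from `w'` to `Z` runs through `w`, its discretisation `w ∘ t ∘ s` and the discretised
  -- limit; each link gives one term of the bound.
  set a := ∫ ω, g (toLInf (w' ω)) ∂ν
  set b := ∫ ω, g (toLInf (w ω)) ∂ν
  set c := ∫ ω, g (LInf.comp (t ∘ s) (toLInf (w ω))) ∂ν
  set e := ∫ ω, g (LInf.comp (t ∘ s) (Z ω)) ∂Q
  set f := ∫ ω, g (Z ω) ∂Q
  calc ‖a - f‖ₑ = ‖(a - b) + (b - c) + (c - e) + (e - f)‖ₑ := by congr 1; ring
    _ ≤ ‖a - b‖ₑ + ‖b - c‖ₑ + ‖c - e‖ₑ + ‖e - f‖ₑ :=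
        (enorm_add_le _ _).trans (add_le_add_left ((enorm_add_le _ _).trans
          (add_le_add_left (enorm_add_le _ _) _)) _)
    _ ≤ _ := add_le_add (add_le_add (add_le_add (h1.trans h1') h2) h3) h4

/-- If `W n` converges weakly to a tight limit, jointly in data and multipliers, and the fidis
converge conditionally on the data, then every process `W' n` close to `W n` converges
conditionally on the data, in the bounded Lipschitz distance. -/
theorem tendstoZeroInOuterProb_dBL (hZ : IsTightBorel Q Z) {W W' : ℕ → Ω₁ × Ω₂ → ι → ℝ}
    (hW : ConvergesWeakly (μ.prod ν) W Q Z)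
    (hWm : ∀ᶠ n in atTop, ∀ ω₁, AEStronglyMeasurable (fun ω₂ => toLInf (W n (ω₁, ω₂))) ν)
    (hW' : ∀ᶠ n in atTop, ∀ ω, Memℓp (W' n ω) ∞)
    (hWm' : ∀ᶠ n in atTop, ∀ ω₁, AEStronglyMeasurable (fun ω₂ => toLInf (W' n (ω₁, ω₂))) ν)
    (hfidi : ∀ (l : ℕ) (t : Fin l → ι), TendstoZeroInOuterProb μ fun n ω₁ =>
      dBL ν (fun ω₂ k => W n (ω₁, ω₂) (t k)) Q (fun ω k => Z ω (t k)))
    (hd : TendstoZeroInOuterProb μ fun n ω₁ =>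
      ∫⁻ ω₂, ⨆ i, ‖W' n (ω₁, ω₂) i - W n (ω₁, ω₂) i‖ₑ ∂ν) :
    TendstoZeroInOuterProb μ fun n ω₁ => dBL ν (fun ω₂ => toLInf (W' n (ω₁, ω₂))) Q Z := by
  rw [tendstoZeroInOuterProb_iff]
  intro ε' η' hε' hη'
  obtain ⟨ε, hε, rfl⟩ : ∃ ε, 0 < ε ∧ 4 * ε = ε' := ⟨ε' / 4, by positivity, by ring⟩
  obtain ⟨η, hη, rfl⟩ : ∃ η, 0 < η ∧ 3 * η = η' := ⟨η' / 3, by positivity, by ring⟩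
  -- The discretisation error of `Z` has mean at most `β + 2 * β`, so that of `W n` is eventually
  -- below `4 * β`. The bound `ε` serves the limit term, the bound `ε * η` serves Markov's
  -- inequality at level `ε`.
  set β : ℝ := min ε (ε * η) / 4 with hβ_def
  have hεη : 0 < min ε (ε * η) := lt_min hε (mul_pos hε hη)
  have hβ : 0 < β := by positivity
  obtain ⟨K, hK, hQK⟩ := hZ.exists_isCompact hβ
  obtain ⟨l, t, s, hts⟩ := LInf.exists_finite_approx hK hβ
  set h : LInf ι → ℝ := fun z => min 2 (dist z (LInf.comp (t ∘ s) z)) with hh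
  have hc : Continuous h := continuous_const.min (continuous_id.dist (LInf.continuous_comp _))
  have h0 : ∀ z, 0 ≤ h z := fun z => le_min zero_le_two dist_nonneg
  have h2 : ∀ z, h z ≤ 2 := fun z => min_le_left _ _
  have hhZ : ∫ ω, h (Z ω) ∂Q ≤ 3 * β := by
    have := hZ.integral_comp_le hc hβ.le (C := 2)
      (fun z => by rw [abs_of_nonneg (h0 z)]; exact h2 z) hK (fun z hz => by
        refine (min_le_right _ _).trans ?_
        rw [dist_eq_norm]
        exact LInf.norm_le hβ.le (hts z hz))
    linarith
  have hβ1 : 4 * β ≤ ε := by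
    rw [hβ_def]; linarith [min_le_left ε (ε * η)]
  have hβ2 : 4 * β ≤ ε * η := by
    rw [hβ_def]; linarith [min_le_right ε (ε * η)]
  have hlim := hW.tendsto_of_nonneg hc h0 h2
  filter_upwards [hWm, hWm', hW', hW.1, tendstoZeroInOuterProb_iff.1 hd ε η hε hη,
    tendstoZeroInOuterProb_iff.1 (hfidi l t) ε η hε hη,
    hlim.eventually_lt_const (show ∫ ω, h (Z ω) ∂Q < 4 * β by linarith)]
    with n hm hm' hb' hb e1 e3 e2
  -- The discretisation error of `W n` need not be jointly measurable, so Fubini is applied to a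
  -- measurable majorant.
  obtain ⟨U, hUm, hUi, hTU, hUlt⟩ := exists_majorant_of_outerExp_lt (fun ω => h2 _) e2
  set T₂ : Ω₁ → ℝ≥0∞ := fun ω₁ => ∫⁻ ω₂, ENNReal.ofReal (h (toLInf (W n (ω₁, ω₂)))) ∂ν
  have e2' : μ {ω₁ | ENNReal.ofReal ε < T₂ ω₁} ≤ ENNReal.ofReal η := by
    have hmaj : ∀ ω₁, T₂ ω₁ ≤ ∫⁻ ω₂, ENNReal.ofReal (U (ω₁, ω₂)) ∂ν := fun ω₁ =>
      lintegral_mono fun ω₂ => ENNReal.ofReal_le_ofReal (hTU _)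
    have hint : ∫⁻ ω₁, ∫⁻ ω₂, ENNReal.ofReal (U (ω₁, ω₂)) ∂ν ∂μ =
        ENNReal.ofReal (∫ ω, U ω ∂(μ.prod ν)) := by
      rw [ofReal_integral_eq_lintegral_ofReal hUi
        (Eventually.of_forall fun ω => (h0 _).trans (hTU ω)),
        lintegral_prod _ hUm.ennreal_ofReal.aemeasurable]
    have hmark := meas_ge_le_lintegral_div (μ := μ)
      (f := fun ω₁ => ∫⁻ ω₂, ENNReal.ofReal (U (ω₁, ω₂)) ∂ν)
      hUm.ennreal_ofReal.lintegral_prod_right'.aemeasurable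
      (ε := ENNReal.ofReal ε) (by simpa using hε) ENNReal.ofReal_ne_top
    refine (measure_mono fun ω₁ hω₁ => ?_).trans (hmark.trans ?_)
    · exact (le_of_lt hω₁).trans (hmaj ω₁)
    · rw [hint, ← ENNReal.ofReal_div_of_pos hε]
      refine ENNReal.ofReal_le_ofReal ?_
      rw [div_le_iff₀ hε]
      linarith
  have hsub : {ω₁ | ENNReal.ofReal (4 * ε) < dBL ν (fun ω₂ => toLInf (W' n (ω₁, ω₂))) Q Z} ⊆
      {ω₁ | ENNReal.ofReal ε < ∫⁻ ω₂, ⨆ i, ‖W' n (ω₁, ω₂) i - W n (ω₁, ω₂) i‖ₑ ∂ν} ∪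
      {ω₁ | ENNReal.ofReal ε < T₂ ω₁} ∪
      {ω₁ | ENNReal.ofReal ε <
        dBL ν (fun ω₂ k => W n (ω₁, ω₂) (t k)) Q (fun ω k => Z ω (t k))} := by
    intro ω₁ hω₁
    by_contra hcon
    simp only [mem_union, mem_ofPred_eq, not_or, not_lt] at hcon
    refine (not_le.2 (mem_ofPred_eq ▸ hω₁)) ?_
    refine (dBL_le_of_finite_approx hZ (fun ω₂ => hb (ω₁, ω₂)) (fun ω₂ => hb' (ω₁, ω₂))
      (hm ω₁) (hm' ω₁) t s).trans ?_
    have h4 : ENNReal.ofReal (∫ ω, h (Z ω) ∂Q) ≤ ENNReal.ofReal ε :=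
      ENNReal.ofReal_le_ofReal (by linarith)
    refine (add_le_add (add_le_add (add_le_add hcon.1.1 hcon.1.2) hcon.2) h4).trans ?_
    rw [← ENNReal.ofReal_add hε.le hε.le, ← ENNReal.ofReal_add (by positivity) hε.le,
      ← ENNReal.ofReal_add (by positivity) hε.le]
    exact ENNReal.ofReal_le_ofReal (by linarith)
  refine (measure_mono hsub).trans ((measure_union_le _ _).trans
    ((add_le_add ((measure_union_le _ _).trans (add_le_add e1 e2')) e3).trans ?_))
  rw [← ENNReal.ofReal_add hη.le hη.le, ← ENNReal.ofReal_add (by positivity) hη.le]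
  exact ENNReal.ofReal_le_ofReal (by linarith)

end Conditional

/-! ### Weighted sums of multipliers -/

section Multipliers

/-- Centred, square integrable and orthonormal random variables. -/
structure IsCentredOrthonormal {Ω₂ : Type*} [MeasurableSpace Ω₂] (ξ : ℕ → Ω₂ → ℝ)
    (ν : Measure Ω₂) : Prop where
  memLp : ∀ j, MemLp (ξ j) 2 ν
  integral_eq_zero : ∀ j, ∫ ω, ξ j ω ∂ν = 0
  integral_mul : ∀ i j, ∫ ω, ξ i ω * ξ j ω ∂ν = if i = j then 1 else 0

theorem IsCentredOrthonormal.of_iid {Ω₂ : Type*} [MeasurableSpace Ω₂] {ξ : ℕ → Ω₂ → ℝ}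
    {ν : Measure Ω₂} [IsProbabilityMeasure ν] (hξm : ∀ j, Measurable (ξ j))
    (hξind : iIndepFun ξ ν) (hξid : ∀ j, IdentDistrib (ξ j) (ξ 0) ν ν) (hξL2 : MemLp (ξ 0) 2 ν)
    (hξmean : ∫ ω, ξ 0 ω ∂ν = 0) (hξvar : variance (ξ 0) ν = 1) : IsCentredOrthonormal ξ ν := by
  have hmean : ∀ j, ∫ ω, ξ j ω ∂ν = 0 := fun j => (hξid j).integral_eq.trans hξmean
  refine ⟨fun j => (hξid j).memLp_iff.2 hξL2, hmean, fun i j => ?_⟩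
  split_ifs with h
  · subst h
    have h1 := variance_of_integral_eq_zero (hξm i).aemeasurable (hmean i)
    rw [(hξid i).variance_eq, hξvar] at h1
    rw [h1]
    exact integral_congr_ae (Eventually.of_forall fun ω => (pow_two _).symm)
  · have h1 := (hξind.indepFun h).integral_fun_mul_eq_mul_integral
      (hξm i).aestronglyMeasurable (hξm j).aestronglyMeasurable
    rw [h1, hmean, zero_mul]

variable {Ω₂ Ω' : Type*} [MeasurableSpace Ω₂] [MeasurableSpace Ω'] {ξ : ℕ → Ω₂ → ℝ}
  {ν : Measure Ω₂} {Q : Measure Ω'}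

/-- A Lipschitz function which detects values far from `c`. -/
def excess (c T x : ℝ) : ℝ := min 1 (max 0 (|x - c| - T))

theorem excess_nonneg (c T x : ℝ) : 0 ≤ excess c T x := le_min zero_le_one (le_max_left _ _)

theorem excess_le_one (c T x : ℝ) : excess c T x ≤ 1 := min_le_left _ _

theorem continuous_excess (c T : ℝ) : Continuous (excess c T) := by
  unfold excess
  fun_prop

theorem excess_mem_BL₁ (c T : ℝ) : excess c T ∈ BL₁ ℝ := by
  refine ⟨fun x => by rw [abs_of_nonneg (excess_nonneg _ _ _)]; exact excess_le_one _ _ _,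
    fun x y => ?_⟩
  have h := abs_abs_sub_abs_le_abs_sub (x - c) (y - c)
  rw [sub_sub_sub_cancel_right] at h
  rw [Real.dist_eq]
  refine le_trans ?_ h
  unfold excess
  grind

theorem abs_integral_excess_sub_le {η : ℝ} (hη : 0 ≤ η) {V : Ω₂ → ℝ} {Y : Ω' → ℝ}
    (h : dBL ν (fun ω (_ : Fin 1) => V ω) Q (fun ω _ => Y ω) ≤ ENNReal.ofReal η) (c T : ℝ) :
    |(∫ ω, excess c T (V ω) ∂ν) - ∫ ω, excess c T (Y ω) ∂Q| ≤ η := by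
  have hg : (fun y : Fin 1 → ℝ => excess c T (y 0)) ∈ BL₁ (Fin 1 → ℝ) :=
    ⟨fun _ => (excess_mem_BL₁ c T).1 _, fun y₁ y₂ =>
      ((excess_mem_BL₁ c T).2 _ _).trans (dist_le_pi_dist y₁ y₂ 0)⟩
  have h1 := (le_dBL (ν := ν) (V := fun ω (_ : Fin 1) => V ω) (Q := Q)
    (W := fun ω _ => Y ω) hg).trans h
  rw [Real.enorm_eq_ofReal_abs] at h1
  exact (ENNReal.ofReal_le_ofReal_iff hη).1 h1

theorem IsCentredOrthonormal.memLp_sum (hξ : IsCentredOrthonormal ξ ν) (m : ℕ) (a : ℕ → ℝ) :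
    MemLp (fun ω => ∑ j ∈ Finset.range m, ξ j ω * a j) 2 ν :=
  memLp_finsetSum _ fun j _ => (hξ.memLp j).mul_const (a j)

theorem IsCentredOrthonormal.integral_sum_sq (hξ : IsCentredOrthonormal ξ ν) (m : ℕ)
    (a : ℕ → ℝ) :
    ∫ ω, (∑ j ∈ Finset.range m, ξ j ω * a j) ^ 2 ∂ν = ∑ j ∈ Finset.range m, a j ^ 2 := by
  have hi : ∀ i j, Integrable (fun ω => ξ i ω * a i * (ξ j ω * a j)) ν := fun i j =>
    ((hξ.memLp i).mul_const (a i)).integrable_mul ((hξ.memLp j).mul_const (a j))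
  simp only [pow_two, Finset.sum_mul_sum]
  rw [integral_finsetSum _ fun i _ => integrable_finsetSum _ fun j _ => hi i j]
  refine Finset.sum_congr rfl fun i hi' => ?_
  rw [integral_finsetSum _ fun j _ => hi i j]
  have : ∀ j, ∫ ω, ξ i ω * a i * (ξ j ω * a j) ∂ν = if i = j then a i * a j else 0 := by
    intro j
    have h1 : ∀ ω, ξ i ω * a i * (ξ j ω * a j) = ξ i ω * ξ j ω * (a i * a j) := fun ω => by ring
    simp only [h1]
    rw [integral_mul_const, hξ.integral_mul]
    split_ifs <;> simp
  simp only [this, Finset.sum_ite_eq, if_pos hi']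

variable [IsProbabilityMeasure ν]

theorem IsCentredOrthonormal.integral_sum (hξ : IsCentredOrthonormal ξ ν) (m : ℕ) (a : ℕ → ℝ) :
    ∫ ω, ∑ j ∈ Finset.range m, ξ j ω * a j ∂ν = 0 := by
  rw [integral_finsetSum _ fun j _ =>
    ((hξ.memLp j).integrable one_le_two).mul_const (a j)]
  exact Finset.sum_eq_zero fun j _ => by rw [integral_mul_const, hξ.integral_eq_zero, zero_mul]

/-- Linear combinations of finitely many orthonormal variables are uniformly spread out. -/
theorem IsCentredOrthonormal.exists_anticoncentration (hξ : IsCentredOrthonormal ξ ν) (m : ℕ) :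
    ∃ p : ℝ, 0 < p ∧ ∀ a : ℕ → ℝ, 0 < ∑ j ∈ Finset.range m, a j ^ 2 →
      p ≤ ν.real {ω | (∑ j ∈ Finset.range m, a j ^ 2) / 4 ≤
        (∑ j ∈ Finset.range m, ξ j ω * a j) ^ 2} := by
  -- By Cauchy–Schwarz the squared sum is at most `R * ∑ a j ^ 2`. Truncating the integrable `R` at
  -- a level `L` gives a second moment estimate uniform in the weights.
  set R : Ω₂ → ℝ := fun ω => ∑ j ∈ Finset.range m, ξ j ω ^ 2 with hR
  have hR0 : ∀ ω, 0 ≤ R ω := fun ω => Finset.sum_nonneg fun j _ => sq_nonneg _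
  have hRi : Integrable R ν := integrable_finsetSum _ fun j _ => (hξ.memLp j).integrable_sq
  have hmax : ∀ L : ℝ, Integrable (fun ω => max 0 (R ω - L)) ν := fun L =>
    (integrable_const (0 : ℝ)).sup (hRi.sub (integrable_const L))
  have hlim : Tendsto (fun L : ℕ => ∫ ω, max 0 (R ω - L) ∂ν) atTop (𝓝 (∫ _, (0 : ℝ) ∂ν)) := by
    refine tendsto_integral_of_dominated_convergence R (fun L => (hmax L).aestronglyMeasurable)
      hRi (fun L => Eventually.of_forall fun ω => ?_) (Eventually.of_forall fun ω => ?_)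
    · rw [Real.norm_of_nonneg (le_max_left _ _)]
      exact max_le (hR0 ω) (by linarith [Nat.cast_nonneg (α := ℝ) L])
    · refine tendsto_const_nhds.congr' ?_
      filter_upwards [eventually_ge_atTop ⌈R ω⌉₊] with L hL
      exact (max_eq_left (sub_nonpos.2 (Nat.ceil_le.1 hL))).symm
  rw [integral_zero] at hlim
  obtain ⟨L, hL, hL1⟩ := ((hlim.eventually_lt_const
    (show (0 : ℝ) < 1 / 4 by norm_num)).and (eventually_ge_atTop 1)).exists
  have hLpos : (0 : ℝ) < L := by exact_mod_cast hL1
  refine ⟨1 / (2 * L), by positivity, fun a ha => ?_⟩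
  set s := ∑ j ∈ Finset.range m, a j ^ 2 with hs
  set V : Ω₂ → ℝ := fun ω => ∑ j ∈ Finset.range m, ξ j ω * a j with hV
  have hVL := hξ.memLp_sum m a
  have hG : NullMeasurableSet {ω | s / 4 ≤ V ω ^ 2} ν :=
    nullMeasurableSet_le aemeasurable_const (hVL.aestronglyMeasurable.aemeasurable.pow_const 2)
  set G := {ω | s / 4 ≤ V ω ^ 2} with hGdef
  have hGi : Integrable (G.indicator (1 : Ω₂ → ℝ)) ν :=
    (integrable_const (1 : ℝ)).indicator₀ hG
  have hpt : ∀ ω, V ω ^ 2 ≤ s / 4 + s * L * G.indicator 1 ω + s * max 0 (R ω - L) := by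
    intro ω
    have hCS : V ω ^ 2 ≤ R ω * s := Finset.sum_mul_sq_le_sq_mul_sq _ _ _
    have h0 : 0 ≤ max 0 (R ω - L) := le_max_left _ _
    have h1 : R ω - L ≤ max 0 (R ω - L) := le_max_right _ _
    by_cases hω : ω ∈ G
    · rw [indicator_of_mem hω, Pi.one_apply]
      nlinarith
    · rw [indicator_of_notMem hω]
      have : V ω ^ 2 < s / 4 := not_le.1 hω
      nlinarith [mul_nonneg ha.le h0]
  -- The outer terms contribute at most `s / 4` each, leaving at least `s / 2` for the middle one;
  -- hence the constant `1 / (2 * L)`.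
  have hint : s ≤ s / 4 + s * L * ν.real G + s * ∫ ω, max 0 (R ω - L) ∂ν := by
    have i1 : Integrable (fun ω => s / 4 + s * L * G.indicator (1 : Ω₂ → ℝ) ω) ν :=
      (integrable_const _).add (hGi.const_mul _)
    calc s = ∫ ω, V ω ^ 2 ∂ν := (hξ.integral_sum_sq m a).symm
      _ ≤ ∫ ω, (s / 4 + s * L * G.indicator 1 ω + s * max 0 (R ω - L)) ∂ν :=
        integral_mono hVL.integrable_sq (i1.add ((hmax L).const_mul s)) hpt
      _ = _ := by
        rw [integral_add i1 ((hmax L).const_mul s),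
          integral_add (integrable_const _) (hGi.const_mul _), integral_const_mul,
          integral_const_mul, integral_indicator₀ hG]
        simp
  rw [div_le_iff₀ (by positivity)]
  have h2 : s * ∫ ω, max 0 (R ω - L) ∂ν ≤ s * (1 / 4) := mul_le_mul_of_nonneg_left hL.le ha.le
  have h3 : 0 ≤ s * (ν.real G * (2 * L) - 1) := by linarith
  linarith [nonneg_of_mul_nonneg_right h3 ha]

theorem integrable_excess {Ω : Type*} [MeasurableSpace Ω] {P : Measure Ω} [IsFiniteMeasure P]
    {V : Ω → ℝ} (hV : AEMeasurable V P) (c T : ℝ) : Integrable (fun ω => excess c T (V ω)) P :=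
  BL₁.integrable_comp (excess_mem_BL₁ c T) hV.aestronglyMeasurable

/-- If the law of `∑ ξ_j a_j` is close to a given law, then the weights are bounded. -/
theorem IsCentredOrthonormal.exists_weights_bound [IsProbabilityMeasure Q]
    (hξ : IsCentredOrthonormal ξ ν) (m : ℕ)
    {Y : Ω' → ℝ} (hY : AEMeasurable Y Q) :
    ∃ B η : ℝ, 0 ≤ B ∧ 0 < η ∧ ∀ a : ℕ → ℝ,
      dBL ν (fun ω (_ : Fin 1) => ∑ j ∈ Finset.range m, ξ j ω * a j) Q (fun ω _ => Y ω) ≤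
        ENNReal.ofReal η → ∑ j ∈ Finset.range m, a j ^ 2 ≤ B := by
  obtain ⟨p, hp, hanti⟩ := hξ.exists_anticoncentration m
  have hlim : Tendsto (fun T : ℕ => ∫ ω, excess 0 T (Y ω) ∂Q) atTop (𝓝 (∫ _, (0 : ℝ) ∂Q)) := by
    refine tendsto_integral_of_dominated_convergence (fun _ => 1)
      (fun T => (integrable_excess hY 0 T).aestronglyMeasurable) (integrable_const _)
      (fun T => Eventually.of_forall fun ω => (excess_mem_BL₁ 0 T).1 _)
      (Eventually.of_forall fun ω => ?_)
    refine tendsto_const_nhds.congr' ?_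
    filter_upwards [eventually_ge_atTop ⌈|Y ω|⌉₊] with T hT
    have : |Y ω| ≤ T := Nat.ceil_le.1 hT
    simp [excess, this]
  rw [integral_zero] at hlim
  obtain ⟨T, hT⟩ := (hlim.eventually_lt_const (show (0 : ℝ) < p / 4 by positivity)).exists
  -- Larger weights would push the sum beyond `T + 1` with probability at least `p`, whereas
  -- closeness to `Y` allows at most `p / 4 + p / 4`.
  refine ⟨4 * ((T : ℝ) + 1) ^ 2, p / 4, by positivity, by positivity, fun a ha => ?_⟩
  by_contra! hcon
  have hpos : 0 < ∑ j ∈ Finset.range m, a j ^ 2 := lt_of_le_of_lt (by positivity) hcon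
  have h1 := hanti a hpos
  have hVm : AEMeasurable (fun ω => ∑ j ∈ Finset.range m, ξ j ω * a j) ν :=
    (hξ.memLp_sum m a).aestronglyMeasurable.aemeasurable
  have h2 := mul_meas_ge_le_integral_of_nonneg (μ := ν)
    (Eventually.of_forall fun ω => excess_nonneg 0 T (∑ j ∈ Finset.range m, ξ j ω * a j))
    (integrable_excess hVm 0 T) 1
  have h3 : ν.real {ω | (∑ j ∈ Finset.range m, a j ^ 2) / 4 ≤
        (∑ j ∈ Finset.range m, ξ j ω * a j) ^ 2} ≤
      ν.real {ω | 1 ≤ excess 0 T (∑ j ∈ Finset.range m, ξ j ω * a j)} := by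
    refine measureReal_mono fun ω hω => ?_
    simp only [mem_ofPred_eq] at hω ⊢
    have h4 : (T : ℝ) + 1 ≤ |∑ j ∈ Finset.range m, ξ j ω * a j| := by
      have := sq_le_sq.1 (show ((T : ℝ) + 1) ^ 2 ≤ (∑ j ∈ Finset.range m, ξ j ω * a j) ^ 2 by
        linarith)
      rwa [abs_of_nonneg (show (0 : ℝ) ≤ (T : ℝ) + 1 by positivity)] at this
    refine le_min le_rfl (le_max_of_le_right ?_)
    rw [sub_zero]
    linarith
  have h5 := (abs_le.1 (abs_integral_excess_sub_le (by positivity) ha 0 T)).2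
  linarith

/-- If the laws of sums `∑ ξ_j a_j` with bounded weights approach a constant, then the constant
is zero. -/
theorem IsCentredOrthonormal.eq_zero_of_approx (hξ : IsCentredOrthonormal ξ ν) (m : ℕ)
    {Y : Ω' → ℝ} {c B : ℝ} (hY : ∀ᵐ ω ∂Q, Y ω = c)
    (h : ∀ η : ℝ, 0 < η → ∃ a : ℕ → ℝ, ∑ j ∈ Finset.range m, a j ^ 2 ≤ B ∧
      dBL ν (fun ω (_ : Fin 1) => ∑ j ∈ Finset.range m, ξ j ω * a j) Q (fun ω _ => Y ω) ≤
        ENNReal.ofReal η) : c = 0 := by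
  -- As the sum `V` is centred, `|c| ≤ E|V - c|`. The part of `|V - c|` up to `K` is controlled by
  -- the distance to the constant, taken as `1 / K ^ 2`, and the part above `K` by the second moment
  -- divided by `K`.
  have key : ∀ K : ℕ, 1 ≤ K → |c| ≤ (1 + B + c ^ 2) / K := by
    intro K hK
    have hK1 : (1 : ℝ) ≤ K := by exact_mod_cast hK
    have hKpos : (0 : ℝ) < K := by linarith
    obtain ⟨a, haB, ha⟩ := h (1 / (K : ℝ) ^ 2) (by positivity)
    set V : Ω₂ → ℝ := fun ω => ∑ j ∈ Finset.range m, ξ j ω * a j with hV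
    have hVL : MemLp V 2 ν := hξ.memLp_sum m a
    have hVi : Integrable V ν := hVL.integrable one_le_two
    have hVcL : MemLp (fun ω => V ω - c) 2 ν := hVL.sub (memLp_const c)
    have h1 := (abs_le.1 (abs_integral_excess_sub_le (by positivity) ha c 0)).2
    have h2 : ∫ ω, excess c 0 (Y ω) ∂Q = 0 := by
      rw [integral_congr_ae (g := fun _ => (0 : ℝ))]
      · simp
      · filter_upwards [hY] with ω hω
        simp [excess, hω]
    have h3 : ∫ ω, (V ω - c) ^ 2 ∂ν = (∑ j ∈ Finset.range m, a j ^ 2) + c ^ 2 := by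
      have e : ∀ ω, (V ω - c) ^ 2 = V ω ^ 2 + V ω * (-2 * c) + c ^ 2 := fun ω => by ring
      simp only [e]
      have i1 : Integrable (fun ω => V ω ^ 2 + V ω * (-2 * c)) ν :=
        hVL.integrable_sq.add (hVi.mul_const _)
      rw [integral_add i1 (integrable_const _),
        integral_add hVL.integrable_sq (hVi.mul_const _), integral_mul_const, hξ.integral_sum,
        hξ.integral_sum_sq]
      simp
    have hpt : ∀ ω, |V ω - c| ≤ K * excess c 0 (V ω) + (V ω - c) ^ 2 / K := by
      intro ω
      have hsq : (V ω - c) ^ 2 = |V ω - c| ^ 2 := (sq_abs _).symm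
      have h0 := abs_nonneg (V ω - c)
      rw [excess, sub_zero, max_eq_right h0, hsq]
      set y := |V ω - c|
      have hy2 : 0 ≤ y ^ 2 / K := by positivity
      rcases le_total y 1 with h' | h'
      · rw [min_eq_right h']
        nlinarith
      · rw [min_eq_left h']
        rcases le_total y K with h'' | h''
        · linarith
        · have : y ≤ y ^ 2 / K := by
            rw [le_div_iff₀ hKpos]
            nlinarith
          linarith
    have hei := integrable_excess hVL.aestronglyMeasurable.aemeasurable c 0
    have h4 : |c| ≤ ∫ ω, |V ω - c| ∂ν := by
      have := abs_integral_le_integral_abs (μ := ν) (f := fun ω => V ω - c)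
      rw [integral_sub hVi (integrable_const c), hξ.integral_sum] at this
      simpa using this
    have h5 : ∫ ω, |V ω - c| ∂ν ≤ ∫ ω, (K * excess c 0 (V ω) + (V ω - c) ^ 2 / K) ∂ν :=
      integral_mono (hVcL.integrable one_le_two).abs
        ((hei.const_mul _).add (hVcL.integrable_sq.div_const _)) hpt
    rw [integral_add (hei.const_mul _) (hVcL.integrable_sq.div_const _), integral_const_mul,
      integral_div, h3] at h5
    have h6 : K * ∫ ω, excess c 0 (V ω) ∂ν ≤ K * (1 / (K : ℝ) ^ 2) :=
      mul_le_mul_of_nonneg_left (by linarith) hKpos.le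
    have h7 : (K : ℝ) * (1 / (K : ℝ) ^ 2) = 1 / K := by field_simp
    have h8 : ((∑ j ∈ Finset.range m, a j ^ 2) + c ^ 2) / K ≤ (B + c ^ 2) / K := by gcongr
    calc |c| ≤ 1 / K + (B + c ^ 2) / K := by linarith
      _ = _ := by ring
  have hlim : Tendsto (fun K : ℕ => (1 + B + c ^ 2) / (K : ℝ)) atTop (𝓝 0) :=
    tendsto_const_div_atTop_nhds_zero_nat _
  have := ge_of_tendsto hlim ((eventually_ge_atTop 1).mono key)
  exact abs_eq_zero.1 (le_antisymm this (abs_nonneg c))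

end Multipliers

/-! ### Degeneracy of the limit when the number of blocks does not tend to infinity -/

section Degenerate

/-- With positive variance, Lebesgue measure would be absolutely continuous with respect to the law,
which would then charge the half-line beyond `B`. -/
theorem HasGaussianLaw.exists_ae_eq_const {Ω' : Type*} [MeasurableSpace Ω'] {Q : Measure Ω'}
    {Y : Ω' → ℝ} (hY : HasGaussianLaw Y Q) (hm : AEMeasurable Y Q) {B : ℝ}
    (hB : ∀ᵐ ω ∂Q, |Y ω| ≤ B) : ∃ c, ∀ᵐ ω ∂Q, Y ω = c := by
  have hlaw := hY.map_eq_gaussianReal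
  set c := ∫ ω, Y ω ∂Q
  set v := (variance Y Q).toNNReal
  have hv : v = 0 := by
    by_contra hv
    have hms : MeasurableSet {x : ℝ | ¬ |x| ≤ B} :=
      (measurableSet_le measurable_norm measurable_const).compl
    have h1 : gaussianReal c v {x | ¬ |x| ≤ B} = 0 := by
      rw [← hlaw, Measure.map_apply_of_aemeasurable hm hms]
      exact hB
    have h2 : volume {x : ℝ | ¬ |x| ≤ B} = 0 := gaussianReal_absolutelyContinuous' c hv h1
    have h3 : Ioi (max B 0) ⊆ {x : ℝ | ¬ |x| ≤ B} := fun x hx =>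
      not_le.2 (lt_of_le_of_lt (le_max_left _ _) (lt_of_lt_of_le hx (le_abs_self x)))
    have h4 := measure_mono_null h3 h2
    simp at h4
  refine ⟨c, ae_of_ae_map hm (p := fun x => x = c) ?_⟩
  rw [hlaw, hv, gaussianReal_zero_var, ae_dirac_eq]
  rfl

/-- The index set may be uncountable, so the null sets cannot simply be united. On a compact set
avoiding `0`, finitely many of the open sets `{z | z i ≠ 0}` suffice, and tightness reduces the
claim to countably many such compact sets. -/
theorem IsTightBorel.ae_eq_zero {Ω' ι : Type*} [MeasurableSpace Ω'] {Q : Measure Ω'}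
    {Z : Ω' → LInf ι} (hZ : IsTightBorel Q Z) (h : ∀ i, ∀ᵐ ω ∂Q, Z ω i = 0) :
    ∀ᵐ ω ∂Q, Z ω = 0 := by
  have hnull : ∀ K : Set (LInf ι), IsCompact K → (0 : LInf ι) ∉ K → Q (Z ⁻¹' K) = 0 := by
    intro K hK h0
    obtain ⟨s, hs⟩ := hK.elim_finite_subcover (fun i : ι => {z : LInf ι | z i ≠ 0})
      (fun i => isOpen_ne_fun (LInf.continuous_apply i) continuous_const) (fun z hz => by
        by_contra hcon
        simp only [mem_iUnion, mem_ofPred_eq, not_exists, not_not] at hcon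
        exact h0 ((show z = 0 from lp.ext (funext hcon)) ▸ hz))
    refine measure_mono_null (preimage_mono hs) ?_
    rw [preimage_iUnion₂]
    exact (measure_biUnion_null_iff s.countable_toSet).2 fun i _ => h i
  refine le_antisymm (ENNReal.le_of_forall_pos_le_add fun ε hε _ => ?_) zero_le
  obtain ⟨K, hK, hQ⟩ := hZ.2 ε (by exact_mod_cast hε)
  have hsub : {ω | Z ω = 0}ᶜ ⊆
      (⋃ k : ℕ, Z ⁻¹' (K ∩ {z | 1 / ((k : ℝ) + 1) ≤ ‖z‖})) ∪ (Z ⁻¹' K)ᶜ := by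
    intro ω hω
    by_cases hK' : Z ω ∈ K
    · obtain ⟨k, hk⟩ := exists_nat_one_div_lt (norm_pos_iff.2 (show Z ω ≠ 0 from hω))
      exact Or.inl (mem_iUnion.2 ⟨k, hK', hk.le⟩)
    · exact Or.inr hK'
  refine (measure_mono hsub).trans ((measure_union_le _ _).trans ?_)
  refine add_le_add (le_of_eq (measure_iUnion_null fun k => hnull _
    (hK.inter_right (isClosed_le continuous_const continuous_norm)) ?_)) hQ
  rintro ⟨-, h0⟩
  have : 0 < 1 / ((k : ℝ) + 1) := by positivity
  simp only [mem_ofPred_eq, norm_zero] at h0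
  linarith

variable {Ω₁ Ω₂ Ω' ι : Type*} [MeasurableSpace Ω₁] [MeasurableSpace Ω₂] [MeasurableSpace Ω']
  {μ : Measure Ω₁} [IsProbabilityMeasure μ] {ν : Measure Ω₂}
  {Q : Measure Ω'} {Z : Ω' → LInf ι} {ξ : ℕ → Ω₂ → ℝ}

theorem ConvergesWeakly.tendsto_measureReal_norm {W : ℕ → Ω₁ → ι → ℝ} (hZ0 : ∀ᵐ ω ∂Q, Z ω = 0)
    (hW : ConvergesWeakly μ W Q Z) {δ : ℝ} (hδ : 0 < δ) :
    Tendsto (fun n => μ.real {ω | δ ≤ ‖toLInf (W n ω)‖}) atTop (𝓝 0) := by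
  set h : LInf ι → ℝ := fun z => min 1 (‖z‖ / δ) with hh
  have hc : Continuous h := continuous_const.min (continuous_norm.div_const δ)
  have h0 : ∀ z, 0 ≤ h z := fun z => le_min zero_le_one (by positivity)
  have h1 : ∀ z, h z ≤ 1 := fun z => min_le_left _ _
  have hlim := hW.tendsto_of_nonneg hc h0 h1
  have hhZ : ∫ ω, h (Z ω) ∂Q = 0 := by
    rw [integral_congr_ae (g := fun _ => (0 : ℝ))]
    · simp
    · filter_upwards [hZ0] with ω hω
      simp [hh, hω]
  rw [hhZ] at hlim
  refine squeeze_zero (fun n => measureReal_nonneg) (fun n => ?_) hlim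
  refine measureReal_le_outerExp (fun ω => h1 _) (fun ω => h0 _) fun ω hω => ?_
  exact le_min le_rfl ((one_le_div hδ).2 hω)

variable [IsProbabilityMeasure ν] [IsProbabilityMeasure Q]

/-- If sums of a bounded number of variables and their multiplier versions have the same Gaussian
limit, then this limit vanishes. -/
theorem ae_eq_zero_of_frequently_eq (hξ : IsCentredOrthonormal ξ ν) (hZ : IsTightBorel Q Z)
    (i : ι) (hG : HasGaussianLaw (fun ω => Z ω i) Q) {W : ℕ → Ω₁ → ι → ℝ}
    (hW : ConvergesWeakly μ W Q Z) {m : ℕ → ℕ} {a : ℕ → Ω₁ → ℕ → ℝ}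
    (hWa : ∀ n ω, W n ω i = ∑ j ∈ Finset.range (m n), a n ω j)
    (hfidi : TendstoZeroInOuterProb μ fun n ω =>
      dBL ν (fun ω₂ (_ : Fin 1) => ∑ j ∈ Finset.range (m n), ξ j ω₂ * a n ω j) Q
        (fun ω' _ => Z ω' i))
    {M : ℕ} (hM : ∃ᶠ n in atTop, m n = M) : ∀ᵐ ω ∂Q, Z ω i = 0 := by
  have hYm : AEMeasurable (fun ω => Z ω i) Q :=
    (hZ.measurable_comp (LInf.continuous_apply i)).aemeasurable
  obtain ⟨B, η, hB, hη, hbound⟩ := hξ.exists_weights_bound M hYm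
  have hT := tendstoZeroInOuterProb_iff.1 hfidi
  -- Cauchy–Schwarz gives `(∑ a j) ^ 2 ≤ M * B` for weights bounded by `B`, and `M * B ≤ (M * B + 1)
  -- ^ 2`; hence `h` vanishes at such sums.
  set h : LInf ι → ℝ := fun z => excess 0 (M * B + 1) (z i) with hh
  have hc : Continuous h := (continuous_excess _ _).comp (LInf.continuous_apply i)
  have h0 : ∀ z, 0 ≤ h z := fun z => excess_nonneg _ _ _
  have h1 : ∀ z, h z ≤ 1 := fun z => excess_le_one _ _ _
  have hlim := hW.tendsto_of_nonneg hc h0 h1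
  have hhZ : ∫ ω, h (Z ω) ∂Q ≤ 0 := by
    by_contra! hpos
    obtain ⟨n, hnM, hn1, hn2, hn3⟩ := (hM.and_eventually ((hlim.eventually_const_lt
      (half_lt_self hpos)).and ((hT η _ hη (half_pos hpos)).and hW.1))).exists
    refine absurd hn1 (not_lt.2 ?_)
    refine (outerExp_le_measureReal (A := {ω | ENNReal.ofReal η < dBL ν (fun ω₂ (_ : Fin 1) =>
      ∑ j ∈ Finset.range (m n), ξ j ω₂ * a n ω j) Q (fun ω' _ => Z ω' i)}) (fun ω => h0 _)
      fun ω => ?_).trans (ENNReal.toReal_le_of_le_ofReal (half_pos hpos).le hn2)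
    by_cases hω : ω ∈ {ω | ENNReal.ofReal η < dBL ν (fun ω₂ (_ : Fin 1) =>
      ∑ j ∈ Finset.range (m n), ξ j ω₂ * a n ω j) Q (fun ω' _ => Z ω' i)}
    · rw [indicator_of_mem hω]
      exact h1 _
    · rw [indicator_of_notMem hω]
      simp only [mem_ofPred_eq, not_lt, hnM] at hω
      have hs := hbound _ hω
      have hCS : (∑ j ∈ Finset.range M, a n ω j) ^ 2 ≤
          M * ∑ j ∈ Finset.range M, a n ω j ^ 2 := by
        simpa using sq_sum_le_card_mul_sum_sq (s := Finset.range M) (f := fun j => a n ω j)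
      have hMB : (M : ℝ) * ∑ j ∈ Finset.range M, a n ω j ^ 2 ≤ M * B :=
        mul_le_mul_of_nonneg_left hs (Nat.cast_nonneg M)
      have hMB0 : 0 ≤ (M : ℝ) * B := by positivity
      have habs : |∑ j ∈ Finset.range M, a n ω j| ≤ M * B + 1 :=
        abs_le_of_sq_le_sq (by nlinarith) (by positivity)
      simp only [hh, toLInf_apply (hn3 ω), hWa, hnM, excess, sub_zero]
      rw [max_eq_left (by linarith), min_eq_right zero_le_one]
  have hae : ∀ᵐ ω ∂Q, |Z ω i| ≤ M * B + 1 := by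
    have hi : Integrable (fun ω => h (Z ω)) Q :=
      hZ.integrable_comp hc (C := 1) fun z => by rw [abs_of_nonneg (h0 z)]; exact h1 z
    have := (integral_eq_zero_iff_of_nonneg (fun ω => h0 (Z ω)) hi).1
      (le_antisymm hhZ (integral_nonneg fun ω => h0 _))
    filter_upwards [this] with ω hω
    by_contra! hcon
    have hpos : 0 < h (Z ω) := by
      simp only [hh, excess, sub_zero]
      exact lt_min one_pos (lt_max_of_lt_right (by linarith))
    exact hpos.ne' hω
  obtain ⟨c, hYc⟩ := HasGaussianLaw.exists_ae_eq_const hG hYm hae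
  have hc0 : c = 0 := by
    refine hξ.eq_zero_of_approx M hYc (B := B) fun η' hη' => ?_
    -- Accuracy `η` bounds the weights and accuracy `η'` is the one requested; an exceptional set of
    -- measure at most `1 / 2` leaves some data point to supply the weights.
    obtain ⟨n, hnM, hn⟩ := (hM.and_eventually (hT (min η η') (1 / 2) (lt_min hη hη')
      (by norm_num))).exists
    obtain ⟨ω, hω⟩ : ∃ ω, ω ∉ {ω | ENNReal.ofReal (min η η') < dBL ν (fun ω₂ (_ : Fin 1) =>
        ∑ j ∈ Finset.range (m n), ξ j ω₂ * a n ω j) Q (fun ω' _ => Z ω' i)} := by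
      by_contra! hcon
      rw [eq_univ_of_forall hcon, measure_univ] at hn
      have : ENNReal.ofReal (1 / 2) < ENNReal.ofReal 1 :=
        (ENNReal.ofReal_lt_ofReal_iff one_pos).2 (by norm_num)
      rw [ENNReal.ofReal_one] at this
      exact absurd hn (not_le.2 this)
    simp only [mem_ofPred_eq, not_lt, hnM] at hω
    exact ⟨a n ω, hbound _ (hω.trans (ENNReal.ofReal_le_ofReal (min_le_left _ _))),
      hω.trans (ENNReal.ofReal_le_ofReal (min_le_right _ _))⟩
  simpa [hc0] using hYc

end Degenerate

/-! ### The bootstrap process -/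

section Bootstrap

/-- A bounded random linear combination of fixed functions is a measurable element of `ℓ^∞`. -/
theorem stronglyMeasurable_toLInf_sum {Ω ι : Type*} [MeasurableSpace Ω] {ξ : ℕ → Ω → ℝ}
    (hξ : ∀ j, Measurable (ξ j)) (m : ℕ) (b : ℕ → ι → ℝ)
    (h : ∀ ω, Memℓp (fun i => ∑ j ∈ Finset.range m, ξ j ω * b j i) ∞) :
    StronglyMeasurable fun ω => toLInf fun i => ∑ j ∈ Finset.range m, ξ j ω * b j i := by
  let comb : (Fin m → ℝ) → ι → ℝ := fun c i => ∑ j, c j * b j i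
  have hadd : ∀ c c', comb (c + c') = comb c + comb c' := fun c c' => by
    ext i
    simp [comb, add_mul, Finset.sum_add_distrib]
  have hsmul : ∀ (x : ℝ) c, comb (x • c) = x • comb c := fun x c => by
    ext i
    simp [comb, Finset.mul_sum, mul_assoc]
  -- The single functions `b j` may be unbounded even when the combinations that occur are bounded.
  -- The bounded combinations form a subspace of coefficients, and a linear extension from it to
  -- `Fin m → ℝ` is automatically continuous.
  let V : Submodule ℝ (Fin m → ℝ) :=
    { carrier := {c | Memℓp (comb c) ∞}
      add_mem' := fun {c c'} hc hc' => by
        simp only [mem_ofPred_eq, hadd] at hc hc' ⊢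
        exact hc.add hc'
      zero_mem' := by
        have : comb 0 = 0 := by ext i; simp [comb]
        simp only [mem_ofPred_eq, this]
        exact zero_memℓp
      smul_mem' := fun x c hc => by
        simp only [mem_ofPred_eq, hsmul] at hc ⊢
        exact hc.const_smul x }
  let L : V →ₗ[ℝ] LInf ι :=
    { toFun := fun c => ⟨comb c.1, c.2⟩
      map_add' := fun c c' => by
        ext i
        exact congrFun (hadd c.1 c'.1) i
      map_smul' := fun x c => by
        ext i
        exact congrFun (hsmul x c.1) i }
  obtain ⟨L', hL'⟩ := L.exists_extend
  have heq : ∀ ω, (fun i => ∑ j ∈ Finset.range m, ξ j ω * b j i) =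
      comb fun j => ξ j ω := fun ω => by
    ext i
    exact (Fin.sum_univ_eq_sum_range (fun j => ξ j ω * b j i) m).symm
  have hmem : ∀ ω, (fun j : Fin m => ξ j ω) ∈ V := fun ω => by
    have := h ω
    rwa [heq] at this
  have hval : (fun ω => toLInf fun i => ∑ j ∈ Finset.range m, ξ j ω * b j i) =
      fun ω => L' fun j => ξ j ω := by
    funext ω
    have h1 : L' (fun j => ξ j ω) = L ⟨_, hmem ω⟩ := by
      rw [← hL']
      rfl
    rw [h1, heq, toLInf_of_memℓp (hmem ω)]
    rfl
  rw [hval]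
  exact L'.continuous_of_finiteDimensional.comp_stronglyMeasurable
    (measurable_pi_lambda (fun ω (j : Fin m) => ξ j ω) fun j => hξ j).stronglyMeasurable

theorem tendsto_atTop_or_frequently_eq (m : ℕ → ℕ) :
    Tendsto m atTop atTop ∨ ∃ M, ∃ᶠ n in atTop, m n = M := by
  by_contra! h
  obtain ⟨h1, h2⟩ := h
  refine h1 (tendsto_atTop.2 fun b => ?_)
  have h3 : ∀ᶠ n in atTop, ∀ M ∈ Finset.range b, m n ≠ M :=
    (eventually_all_finset _).2 fun M _ => h2 M
  filter_upwards [h3] with n hn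
  by_contra hlt
  exact hn (m n) (Finset.mem_range.2 (not_le.1 hlt)) rfl

variable {Ω₁ Ω₂ Ω' : Type*} [MeasurableSpace Ω₁] [MeasurableSpace Ω']
  {μ : Measure Ω₁} {Q : Measure Ω'} {d : ℕ}
  {X : ℕ → ℕ → Ω₁ → Fin d → ℝ} {r : ℕ → ℕ} {𝓕 : Set (BlockSpace d → ℝ)} {ξ : ℕ → Ω₂ → ℝ}

theorem RowwiseStationary.integral_block_eq (hstat : RowwiseStationary μ X)
    {f : BlockSpace d → ℝ} (hf : Measurable f) {n j : ℕ} (hj : j < n / r n) :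
    ∫ ω, f (block X r n j ω) ∂μ = ∫ ω, f (block X r n 0 ω) ∂μ := by
  have hle : j * r n + r n ≤ n := by
    rw [← Nat.succ_mul]
    exact (Nat.mul_le_mul_right _ hj).trans (Nat.div_mul_le_self n (r n))
  have hmk : Measurable (Sigma.mk (r n) : _ → BlockSpace d) := fun s hs =>
    MeasurableSpace.measurableSet_iInf.1 hs (r n)
  have h1 := (hstat n (r n) (j * r n) hle).comp
    (hf.comp hmk)
  have h2 := h1.integral_eq
  simpa [block, Function.comp_def] using h2

/-- The mean of the first `n / r n` multipliers. -/
def multMean (r : ℕ → ℕ) (ξ : ℕ → Ω₂ → ℝ) (n : ℕ) (ω : Ω₂) : ℝ :=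
  ∑ j ∈ Finset.range (n / r n), ξ j ω * ((n / r n : ℕ) : ℝ)⁻¹

/-- The empirical block mean minus the common expectation is, up to the normalisation, `empProc`
divided by the number of blocks. It does not depend on `j`, so the multipliers enter this term only
through their sum. At least one block is needed for the division. -/
theorem bootProc_eq (hstat : RowwiseStationary μ X) (hF : ∀ f ∈ 𝓕, IsClusterFunctional f)
    {n : ℕ} (hn : 1 ≤ n / r n) (ω₁ : Ω₁) (ω₂ : Ω₂) :
    bootProc μ X r ξ 𝓕 n (ω₁, ω₂) =
      multProc μ X r ξ 𝓕 n (ω₁, ω₂) + (-multMean r ξ n ω₂) • empProc μ X r 𝓕 n ω₁ := by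
  ext f
  simp only [bootProc, multProc, empProc, multMean, blockMean, Pi.add_apply, Pi.smul_apply,
    smul_eq_mul]
  have hm : ((n / r n : ℕ) : ℝ) ≠ 0 := by positivity
  have hint : ∀ j ∈ Finset.range (n / r n),
      ∫ ω, f.1 (block X r n j ω) ∂μ = ∫ ω, f.1 (block X r n 0 ω) ∂μ := fun j hj =>
    hstat.integral_block_eq (hF f.1 f.2).measurable (Finset.mem_range.1 hj)
  have e1 : ∑ j ∈ Finset.range (n / r n),
      ξ j ω₂ * (f.1 (block X r n j ω₁) - ∫ ω', f.1 (block X r n j ω') ∂μ) =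
      ∑ j ∈ Finset.range (n / r n),
      ξ j ω₂ * (f.1 (block X r n j ω₁) - ∫ ω', f.1 (block X r n 0 ω') ∂μ) :=
    Finset.sum_congr rfl fun j hj => by rw [hint j hj]
  have e2 : ∑ j ∈ Finset.range (n / r n),
      (f.1 (block X r n j ω₁) - ∫ ω', f.1 (block X r n j ω') ∂μ) =
      ∑ j ∈ Finset.range (n / r n),
      (f.1 (block X r n j ω₁) - ∫ ω', f.1 (block X r n 0 ω') ∂μ) :=
    Finset.sum_congr rfl fun j hj => by rw [hint j hj]
  rw [e1, e2]
  simp only [mul_sub, Finset.sum_sub_distrib, ← Finset.sum_mul, Finset.sum_const,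
    Finset.card_range, nsmul_eq_mul]
  field_simp
  ring

theorem multProc_eq_sum (n : ℕ) (ω₁ : Ω₁) (ω₂ : Ω₂) (f : 𝓕) :
    multProc μ X r ξ 𝓕 n (ω₁, ω₂) f = ∑ j ∈ Finset.range (n / r n),
      ξ j ω₂ * (1 / √(n * exceedProb μ X n) *
        (f.1 (block X r n j ω₁) - ∫ ω', f.1 (block X r n j ω') ∂μ)) := by
  rw [multProc, Finset.mul_sum]
  exact Finset.sum_congr rfl fun j _ => by ring

theorem bootProc_eq_sum (n : ℕ) (ω₁ : Ω₁) (ω₂ : Ω₂) (f : 𝓕) :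
    bootProc μ X r ξ 𝓕 n (ω₁, ω₂) f = ∑ j ∈ Finset.range (n / r n),
      ξ j ω₂ * (1 / √(n * exceedProb μ X n) *
        (f.1 (block X r n j ω₁) - blockMean X r f.1 n ω₁)) := by
  rw [bootProc, Finset.mul_sum]
  exact Finset.sum_congr rfl fun j _ => by ring

variable [MeasurableSpace Ω₂] {ν : Measure Ω₂}

theorem stronglyMeasurable_toLInf_multProc (hξ : ∀ j, Measurable (ξ j)) {n : ℕ}
    (h : ∀ ω, Memℓp (multProc μ X r ξ 𝓕 n ω) ∞) (ω₁ : Ω₁) :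
    StronglyMeasurable fun ω₂ => toLInf (multProc μ X r ξ 𝓕 n (ω₁, ω₂)) := by
  have e := fun ω₂ => funext
    (multProc_eq_sum (μ := μ) (X := X) (r := r) (ξ := ξ) (𝓕 := 𝓕) n ω₁ ω₂)
  have h' := fun ω₂ => h (ω₁, ω₂)
  simp only [e] at h' ⊢
  exact stronglyMeasurable_toLInf_sum hξ _ _ h'

theorem stronglyMeasurable_toLInf_bootProc (hξ : ∀ j, Measurable (ξ j)) {n : ℕ}
    (h : ∀ ω, Memℓp (bootProc μ X r ξ 𝓕 n ω) ∞) (ω₁ : Ω₁) :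
    StronglyMeasurable fun ω₂ => toLInf (bootProc μ X r ξ 𝓕 n (ω₁, ω₂)) := by
  have e := fun ω₂ => funext
    (bootProc_eq_sum (μ := μ) (X := X) (r := r) (ξ := ξ) (𝓕 := 𝓕) n ω₁ ω₂)
  have h' := fun ω₂ => h (ω₁, ω₂)
  simp only [e] at h' ⊢
  exact stronglyMeasurable_toLInf_sum hξ _ _ h'

variable [IsProbabilityMeasure ν]

theorem IsCentredOrthonormal.integrable_multMean (hξ : IsCentredOrthonormal ξ ν) (n : ℕ) :
    Integrable (multMean r ξ n) ν :=
  (hξ.memLp_sum (n / r n) fun _ => ((n / r n : ℕ) : ℝ)⁻¹).integrable one_le_two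

/-- Orthonormality makes the second moment of the mean equal to the reciprocal of the number of
blocks; the first moment then follows from the inequality of arithmetic and geometric means. -/
theorem IsCentredOrthonormal.integral_abs_multMean_le (hξ : IsCentredOrthonormal ξ ν) {n : ℕ}
    (hn : 1 ≤ n / r n) : ∫ ω, |multMean r ξ n ω| ∂ν ≤ 1 / √((n / r n : ℕ) : ℝ) := by
  set m := n / r n with hm
  have hmpos : (0 : ℝ) < m := by exact_mod_cast hn
  have hs : 0 < √(m : ℝ) := Real.sqrt_pos.2 hmpos
  have hss : √(m : ℝ) ^ 2 = m := Real.sq_sqrt hmpos.le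
  have hL := hξ.memLp_sum m fun _ => (m : ℝ)⁻¹
  have hsq : ∫ ω, multMean r ξ n ω ^ 2 ∂ν = 1 / m := by
    have := hξ.integral_sum_sq m fun _ => (m : ℝ)⁻¹
    simp only [multMean, ← hm]
    rw [this, Finset.sum_const, Finset.card_range, nsmul_eq_mul]
    field_simp
  have hi : Integrable (fun ω => multMean r ξ n ω ^ 2) ν := hL.integrable_sq
  have hpt : ∀ ω, |multMean r ξ n ω| ≤
      √(m : ℝ) / 2 * multMean r ξ n ω ^ 2 + 1 / (2 * √(m : ℝ)) := by
    intro ω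
    rw [← sq_abs (multMean r ξ n ω)]
    set y := |multMean r ξ n ω|
    have h0 : 0 ≤ (√(m : ℝ) * y - 1) ^ 2 / (2 * √(m : ℝ)) := by positivity
    have h1 : (√(m : ℝ) * y - 1) ^ 2 / (2 * √(m : ℝ)) =
        √(m : ℝ) / 2 * y ^ 2 + 1 / (2 * √(m : ℝ)) - y := by
      field_simp
      ring
    linarith
  calc ∫ ω, |multMean r ξ n ω| ∂ν
      ≤ ∫ ω, (√(m : ℝ) / 2 * multMean r ξ n ω ^ 2 + 1 / (2 * √(m : ℝ))) ∂ν :=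
        integral_mono (hξ.integrable_multMean n).abs
          ((hi.const_mul _).add (integrable_const _)) hpt
    _ = √(m : ℝ) / 2 * (1 / m) + 1 / (2 * √(m : ℝ)) := by
        rw [integral_add (hi.const_mul _) (integrable_const _), integral_const_mul, hsq]
        simp
    _ = 1 / √(m : ℝ) := by
        nth_rewrite 2 [← hss]
        field_simp
        norm_num

variable [IsProbabilityMeasure μ] [IsProbabilityMeasure Q]

/-- The empirical process, damped by the square root of the number of blocks, vanishes in the
limit: either the number of blocks tends to infinity, or the limit process is degenerate. -/
theorem tendsto_measureReal_empProc {Z : Ω' → LInf 𝓕} (hξ : IsCentredOrthonormal ξ ν)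
    (hr : ∀ᶠ n in atTop, 1 ≤ n / r n) (hZ : IsTightBorel Q Z)
    (hZgauss : IsGaussianProcess (fun (f : 𝓕) (ω : Ω') => Z ω f) Q)
    (hfidi : CondFidiConvergence μ ν X r ξ 𝓕 Q Z)
    (hZn : ConvergesWeakly μ (empProc μ X r 𝓕) Q Z) {δ : ℝ} (hδ : 0 < δ) :
    Tendsto (fun n => μ.real {ω | δ ≤ 1 / √((n / r n : ℕ) : ℝ) *
      ‖toLInf (empProc μ X r 𝓕 n ω)‖}) atTop (𝓝 0) := by
  rcases tendsto_atTop_or_frequently_eq fun n => n / r n with hm | ⟨M, hM⟩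
  · have hκ : Tendsto (fun n => 1 / √((n / r n : ℕ) : ℝ)) atTop (𝓝 0) :=
      tendsto_const_nhds.div_atTop
        (Real.tendsto_sqrt_atTop.comp (tendsto_natCast_atTop_atTop.comp hm))
    rw [Metric.tendsto_atTop']
    intro η hη
    obtain ⟨B, hB, hN⟩ := hZn.exists_norm_bound hZ hη
    have hκB := (hκ.mul_const B).eventually_lt_const (show 0 * B < δ by simpa using hδ)
    obtain ⟨N, hN'⟩ := eventually_atTop.1 (hN.and hκB)
    refine ⟨N, fun n hn => ?_⟩
    obtain ⟨h1, h2⟩ := hN' n hn.le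
    rw [Real.dist_eq, sub_zero, abs_of_nonneg measureReal_nonneg]
    refine (measureReal_mono fun ω hω => ?_).trans_lt h1
    simp only [mem_ofPred_eq] at hω ⊢
    by_contra! hcon
    have : 1 / √((n / r n : ℕ) : ℝ) * ‖toLInf (empProc μ X r 𝓕 n ω)‖ ≤
        1 / √((n / r n : ℕ) : ℝ) * B := by gcongr
    linarith
  · have hZ0 : ∀ᵐ ω ∂Q, Z ω = 0 := hZ.ae_eq_zero fun f => by
      refine ae_eq_zero_of_frequently_eq (μ := μ) (a := fun n ω j =>
        1 / √(n * exceedProb μ X n) *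
          (f.1 (block X r n j ω) - ∫ ω', f.1 (block X r n j ω') ∂μ)) (m := fun n => n / r n)
        hξ hZ f (hZgauss.hasGaussianLaw_eval f) hZn (fun n ω => ?_) ?_ hM
      · rw [empProc, Finset.mul_sum]
      · have := hfidi 1 fun _ => f
        simpa only [multProc_eq_sum] using this
    -- With a degenerate limit the norm itself tends to `0`, and the damping factor is at most `1`.
    refine squeeze_zero' (Eventually.of_forall fun n => measureReal_nonneg) ?_
      (hZn.tendsto_measureReal_norm hZ0 hδ)
    filter_upwards [hr] with n hn
    refine measureReal_mono fun ω hω => ?_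
    simp only [mem_ofPred_eq] at hω ⊢
    refine hω.trans (mul_le_of_le_one_left (norm_nonneg _) ?_)
    rw [div_le_one (by positivity)]
    exact Real.one_le_sqrt.2 (by exact_mod_cast hn)

end Bootstrap

end

/-! ### Proof of the corollary -/

theorem corollary2p7
    {Ω₁ Ω₂ Ω' : Type*} [MeasurableSpace Ω₁] [MeasurableSpace Ω₂] [MeasurableSpace Ω']
    -- the data live on `(Ω₁, μ)`, the multipliers on `(Ω₂, ν)`, the limit process on `(Ω', Q)`
    (μ : Measure Ω₁) [IsProbabilityMeasure μ] (ν : Measure Ω₂) [IsProbabilityMeasure ν]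
    (Q : Measure Ω') [IsProbabilityMeasure Q]
    -- a row-wise stationary scheme and the block lengths
    {d : ℕ} (X : ℕ → ℕ → Ω₁ → Fin d → ℝ) (hX : ∀ n i, Measurable (X n i))
    (hstat : RowwiseStationary μ X) (hv : ∀ n, 1 ≤ n → 0 < exceedProb μ X n)
    (r : ℕ → ℕ) (hr : ∀ n, 1 ≤ n → 1 ≤ r n ∧ r n ≤ n)
    -- a family of cluster functionals
    (𝓕 : Set (BlockSpace d → ℝ)) (hF : ∀ f ∈ 𝓕, IsClusterFunctional f)
    (hint : ∀ f ∈ 𝓕, ∀ n, 1 ≤ n → Integrable (fun ω => f (block X r n 0 ω)) μ)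
    -- i.i.d. multipliers with mean `0` and variance `1`, independent of the data
    (ξ : ℕ → Ω₂ → ℝ) (hξm : ∀ j, Measurable (ξ j)) (hξind : iIndepFun ξ ν)
    (hξid : ∀ j, IdentDistrib (ξ j) (ξ 0) ν ν) (hξL2 : MemLp (ξ 0) 2 ν)
    (hξmean : ∫ ω, ξ 0 ω ∂ν = 0) (hξvar : variance (ξ 0) ν = 1)
    -- the limit: a tight Gaussian process in `ℓ^∞(𝓕)`
    (Z : Ω' → LInf 𝓕) (hZ : IsTightBorel Q Z)
    (hZgauss : IsGaussianProcess (fun (f : 𝓕) (ω : Ω') => Z ω f) Q)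
    -- the assumptions
    (hfidi : CondFidiConvergence μ ν X r ξ 𝓕 Q Z)
    (hD3 : ConditionD3 μ X r 𝓕)
    (hZn : ConvergesWeakly μ (empProc μ X r 𝓕) Q Z)
    (hZnξ : ConvergesWeakly (μ.prod ν) (multProc μ X r ξ 𝓕) Q Z) :
    TendstoZeroInOuterProb μ (fun n ω₁ =>
      ∫⁻ ω₂, ⨆ f : 𝓕,
        ‖bootProc μ X r ξ 𝓕 n (ω₁, ω₂) f - multProc μ X r ξ 𝓕 n (ω₁, ω₂) f‖ₑ ∂ν) ∧
    ConvergesWeakly (μ.prod ν) (bootProc μ X r ξ 𝓕) Q Z ∧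
    TendstoZeroInOuterProb μ (fun n ω₁ =>
      dBL ν (fun ω₂ => toLInf (bootProc μ X r ξ 𝓕 n (ω₁, ω₂))) Q Z) := by
  have hξ := IsCentredOrthonormal.of_iid hξm hξind hξid hξL2 hξmean hξvar
  have hm : ∀ n, 1 ≤ n → 1 ≤ n / r n := fun n hn =>
    (Nat.one_le_div_iff (hr n hn).1).2 (hr n hn).2
  have hm' : ∀ᶠ n in atTop, 1 ≤ n / r n := (eventually_ge_atTop 1).mono hm
  have hN := fun {δ : ℝ} (hδ : 0 < δ) =>
    tendsto_measureReal_empProc hξ hm' hZ hZgauss hfidi hZn hδ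
  have hκpos : ∀ n, 1 ≤ n / r n → 0 < 1 / √((n / r n : ℕ) : ℝ) := fun n hn => by positivity
  have hboot : ∀ᶠ n in atTop, ∀ ω, Memℓp (bootProc μ X r ξ 𝓕 n ω) ∞ := by
    filter_upwards [hm', hZn.1, hZnξ.1] with n hn h1 h2
    rintro ⟨ω₁, ω₂⟩
    rw [bootProc_eq hstat hF hn]
    exact (h2 _).add ((h1 _).const_smul _)
  have hdiff : ∀ n, 1 ≤ n / r n → ∀ ω₁ ω₂ (f : 𝓕), bootProc μ X r ξ 𝓕 n (ω₁, ω₂) f -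
      multProc μ X r ξ 𝓕 n (ω₁, ω₂) f =
      -multMean r ξ n ω₂ * empProc μ X r 𝓕 n ω₁ f := fun n hn ω₁ ω₂ f => by
    rw [bootProc_eq hstat hF hn]
    simp
  have hfirst : TendstoZeroInOuterProb μ fun n ω₁ =>
      ∫⁻ ω₂, ⨆ f : 𝓕,
        ‖bootProc μ X r ξ 𝓕 n (ω₁, ω₂) f - multProc μ X r ξ 𝓕 n (ω₁, ω₂) f‖ₑ ∂ν := by
    rw [tendstoZeroInOuterProb_iff]
    intro ε η hε hη
    filter_upwards [hm', hZn.1, (hN hε).eventually_le_const hη] with n hn hb hle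
    refine (measure_mono fun ω₁ hω₁ => ?_).trans
      ((ENNReal.le_ofReal_iff_toReal_le (measure_ne_top _ _) hη.le).2 hle)
    simp only [mem_ofPred_eq] at hω₁ ⊢
    by_contra! hcon
    refine absurd hω₁ (not_lt.2 ?_)
    calc ∫⁻ ω₂, ⨆ f : 𝓕,
          ‖bootProc μ X r ξ 𝓕 n (ω₁, ω₂) f - multProc μ X r ξ 𝓕 n (ω₁, ω₂) f‖ₑ ∂ν
        ≤ ∫⁻ ω₂, ENNReal.ofReal (|multMean r ξ n ω₂| * ‖toLInf (empProc μ X r 𝓕 n ω₁)‖) ∂ν := by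
          refine lintegral_mono fun ω₂ => iSup_le fun f => ?_
          rw [hdiff n hn, Real.enorm_eq_ofReal_abs, abs_mul, abs_neg]
          refine ENNReal.ofReal_le_ofReal (mul_le_mul_of_nonneg_left ?_ (abs_nonneg _))
          rw [← toLInf_apply (hb ω₁) f]
          exact LInf.abs_apply_le _ f
      _ = ENNReal.ofReal
          (∫ ω₂, |multMean r ξ n ω₂| * ‖toLInf (empProc μ X r 𝓕 n ω₁)‖ ∂ν) :=
          (ofReal_integral_eq_lintegral_ofReal ((hξ.integrable_multMean n).abs.mul_const _)
            (Eventually.of_forall fun ω => by positivity)).symm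
      _ ≤ ENNReal.ofReal ε := by
          refine ENNReal.ofReal_le_ofReal (le_trans ?_ hcon.le)
          rw [integral_mul_const]
          exact mul_le_mul_of_nonneg_right (hξ.integral_abs_multMean_le hn) (norm_nonneg _)
  refine ⟨hfirst, hZnξ.of_sub_tendsto_zero hZ hboot fun δ hδ => ?_,
    tendstoZeroInOuterProb_dBL hZ hZnξ ?_ hboot ?_ hfidi hfirst⟩
  · rw [Metric.tendsto_atTop']
    intro η hη
    -- The product of the multiplier mean and the norm is controlled by one exceptional event for
    -- each factor, so that no joint measurability is needed. Off `A` the damped norm is below `β`;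
    -- Markov's inequality at level `δ * κ / β` bounds the measure of `C` by `β / δ = η / 2`.
    set β : ℝ := δ * (η / 2) with hβ
    have hβpos : 0 < β := by positivity
    obtain ⟨N, hN'⟩ := eventually_atTop.1 (hm'.and (hZn.1.and (hZnξ.1.and (hboot.and
      ((hN hβpos).eventually_lt_const (half_pos hη))))))
    refine ⟨N, fun n hn => ?_⟩
    obtain ⟨h1, hb1, hb2, hb3, h2⟩ := hN' n hn.le
    have hκ := hκpos n h1
    have hEc := hξ.integral_abs_multMean_le h1
    set κ : ℝ := 1 / √((n / r n : ℕ) : ℝ) with hκdef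
    rw [Real.dist_eq, sub_zero, abs_of_nonneg measureReal_nonneg]
    set A : Set Ω₁ := {ω | β ≤ κ * ‖toLInf (empProc μ X r 𝓕 n ω)‖} with hA
    set C : Set Ω₂ := {ω | δ * κ / β ≤ |multMean r ξ n ω|} with hC
    have hsub : {ω | δ ≤ ‖toLInf (bootProc μ X r ξ 𝓕 n ω) - toLInf (multProc μ X r ξ 𝓕 n ω)‖} ⊆
        (A ×ˢ univ) ∪ (univ ×ˢ C) := by
      rintro ⟨ω₁, ω₂⟩ hω
      simp only [mem_ofPred_eq] at hω
      by_contra hcon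
      simp only [mem_union, mem_prod, mem_univ, and_true, true_and, not_or, hA, hC,
        mem_ofPred_eq, not_le] at hcon
      have hle : ‖toLInf (bootProc μ X r ξ 𝓕 n (ω₁, ω₂)) -
          toLInf (multProc μ X r ξ 𝓕 n (ω₁, ω₂))‖ ≤
          |multMean r ξ n ω₂| * ‖toLInf (empProc μ X r 𝓕 n ω₁)‖ := by
        refine LInf.norm_le (by positivity) fun f => ?_
        have e : (toLInf (bootProc μ X r ξ 𝓕 n (ω₁, ω₂)) -
            toLInf (multProc μ X r ξ 𝓕 n (ω₁, ω₂))) f =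
            -multMean r ξ n ω₂ * empProc μ X r 𝓕 n ω₁ f := by
          rw [← hdiff n h1, ← toLInf_apply (hb3 _) f, ← toLInf_apply (hb2 _) f]
          rfl
        rw [e, abs_mul, abs_neg]
        refine mul_le_mul_of_nonneg_left ?_ (abs_nonneg _)
        rw [← toLInf_apply (hb1 ω₁) f]
        exact LInf.abs_apply_le _ f
      have h3 := hcon.2
      rw [lt_div_iff₀ hβpos] at h3
      have h4 : δ * κ ≤ |multMean r ξ n ω₂| * (κ * ‖toLInf (empProc μ X r 𝓕 n ω₁)‖) := by
        calc δ * κ ≤ |multMean r ξ n ω₂| * ‖toLInf (empProc μ X r 𝓕 n ω₁)‖ * κ :=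
              mul_le_mul_of_nonneg_right (hω.trans hle) hκ.le
          _ = _ := by ring
      have h5 : |multMean r ξ n ω₂| * (κ * ‖toLInf (empProc μ X r 𝓕 n ω₁)‖) ≤
          |multMean r ξ n ω₂| * β := mul_le_mul_of_nonneg_left hcon.1.le (abs_nonneg _)
      linarith
    have hCle : ν.real C ≤ η / 2 := by
      have hmark := mul_meas_ge_le_integral_of_nonneg (μ := ν)
        (Eventually.of_forall fun ω => abs_nonneg (multMean r ξ n ω))
        (hξ.integrable_multMean n).abs (δ * κ / β)
      have h6 : δ * κ / β * ν.real C ≤ κ := hmark.trans hEc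
      have h7 : δ * κ / β = κ / (η / 2) := by
        rw [hβ]
        field_simp
      rw [h7, div_mul_eq_mul_div, div_le_iff₀ (half_pos hη)] at h6
      exact le_of_mul_le_mul_left h6 hκ
    calc (μ.prod ν).real _ ≤ (μ.prod ν).real (A ×ˢ univ ∪ univ ×ˢ C) := measureReal_mono hsub
      _ ≤ (μ.prod ν).real (A ×ˢ univ) + (μ.prod ν).real (univ ×ˢ C) := measureReal_union_le _ _
      _ = μ.real A + ν.real C := by simp [measureReal_prod_prod]
      _ < η := by linarith
  · filter_upwards [hZnξ.1] with n hn ω₁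
    exact (stronglyMeasurable_toLInf_multProc hξm hn ω₁).aestronglyMeasurable
  · filter_upwards [hboot] with n hn ω₁
    exact (stronglyMeasurable_toLInf_bootProc hξm hn ω₁).aestronglyMeasurable
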